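/- Let $D$ be a squarefree positive integer and let $(p_0,r_0,q_0)$ and $(p,r,q)$ be triples of positive integers with $$p_0^2+Dr_0^2=q_0^2,\quad \gcd(p_0,q_0)=1,\quad \tfrac{p_0}{q_0}\le\tfrac12,\qquad p^2+Dr^2=q^2,\quad \gcd(p,q)=1,\quad \tfrac pq\le\tfrac12 .$$ Put $$\Omega_D(p,q)=\begin{pmatrix} q & p\\ 0 & r\sqrt D\end{pmatrix}\mathbb Z^2\subset\mathbb R^2,$$ and define $\Omega_D(p_0,q_0)$ in the same way from $(p_0,r_0,q_0)$. A planar lattice $\Lambda=A\mathbb Z^2$ ($A$ real, $\det A\ne0$) is integral if $A^tA$ has integer entries, and well-rounded if it has a basis of nonzero vectors of minimal norm. Two lattices are similar if one is $\alpha U$ times the other with $\alpha>0$ and $U\in O_2(\mathbb R)$. Let $S$ be the set of integral well-rounded sublattices of $\Omega_D(p_0,q_0)$ that are similar to $\Omega_D(p,q)$, and let $$Z_{D,p_0,q_0,p,q}(s)=\sum_{\Lambda\in S}\frac1{|\Omega_D(p_0,q_0):\Lambda|^{s}} .$$ Then: 1. The series $Z_{D,p_0,q_0,p,q}(s)$ converges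 absolutely for $\operatorname{Re}(s)>1$. 2. It has an analytic continuation to $\mathbb C\setminus\{1\}$, with a simple pole at $s=1$. 3. Let $L$ be the group of all $(x,y)\in\mathbb Z^2$ with $$q_0rx+(p_0r-r_0p)y\equiv 0,\qquad (p_0r+r_0p)x+q_0ry\equiv0 \pmod{qr_0}.$$ There are a $\mathbb Z$-basis of $L$, consisting of two elements, and a positive definite binary quadratic form $Q(m,n)=am^2+bmn+cn^2$ with $a,b,c\in\mathbb Z$ such that $qQ(m,n)=(xp_0+yq_0)^2+Dr_0^2x^2$ whenever $(x,y)\in L$ has coordinates $(m,n)$ in this basis. For $\operatorname{Re}(s)>1$ the Epstein zeta-function of $Q$ converges absolutely and $$Z_{D,p_0,q_0,p,q}(s)=\frac1w\left(\frac{r_0q_0}{r}\right)^{s}\sum_{(m,n)\in\mathbb Z^2\setminus\{(0,0)\}}\frac1{Q(m,n)^{s}},$$ where $w=6$ if $q=2p$ and $w=2$ otherwise. -/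

import Mathlib

/-- The Euclidean plane. -/
abbrev Plane : Type := EuclideanSpace ℝ (Fin 2)

/-- The group `A ℤ²` of integer combinations of the columns of the real matrix `A`. -/
def colLattice (A : Matrix (Fin 2) (Fin 2) ℝ) : AddSubgroup Plane :=
  AddSubgroup.closure (Set.range fun j : Fin 2 => (WithLp.toLp 2 fun i => A i j : Plane))

/-- `A` is a basis matrix of the (full rank) planar lattice `Λ`. -/
def IsBasisMatrix (A : Matrix (Fin 2) (Fin 2) ℝ) (Λ : AddSubgroup Plane) : Prop :=
  A.det ≠ 0 ∧ Λ = colLattice A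

/-- `Λ` is integral: for a basis matrix `A`, the Gram matrix `Aᵗ A` has integer entries.
(This does not depend on the choice of the basis matrix.) -/
def IsIntegralLattice (Λ : AddSubgroup Plane) : Prop :=
  ∃ A : Matrix (Fin 2) (Fin 2) ℝ, IsBasisMatrix A Λ ∧
    ∀ i j, ∃ z : ℤ, (A.transpose * A) i j = (z : ℝ)

/-- `x` is a nonzero vector of `Λ` of minimal norm. -/
def IsMinimalVector (Λ : AddSubgroup Plane) (x : Plane) : Prop :=
  x ∈ Λ ∧ x ≠ 0 ∧ ∀ y ∈ Λ, y ≠ 0 → ‖x‖ ^ 2 ≤ ‖y‖ ^ 2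

/-- `Λ` is well-rounded: the minimal vectors of `Λ` contain a basis of `Λ`. -/
def IsWellRounded (Λ : AddSubgroup Plane) : Prop :=
  ∃ A : Matrix (Fin 2) (Fin 2) ℝ, IsBasisMatrix A Λ ∧
    ∀ j, IsMinimalVector Λ (WithLp.toLp 2 fun i => A i j)

/-- Geometric similarity: `Λ₂ = α U Λ₁` with `α > 0` real and `U` a linear isometry. -/
def SimilarLattices (Λ₁ Λ₂ : AddSubgroup Plane) : Prop :=
  ∃ α : ℝ, 0 < α ∧ ∃ U : Plane ≃ₗᵢ[ℝ] Plane,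
    (Λ₂ : Set Plane) = (fun x => α • U x) '' (Λ₁ : Set Plane)

/-- The conditions on the positive integers `D, p, r, q` that parametrize similarity classes of
integral well-rounded planar lattices. -/
structure IsIWRParam (D p r q : ℕ) : Prop where
  D_pos : 0 < D
  p_pos : 0 < p
  r_pos : 0 < r
  q_pos : 0 < q
  eq : p ^ 2 + D * r ^ 2 = q ^ 2
  coprime : Nat.gcd p q = 1
  le_half : (p : ℝ) / (q : ℝ) ≤ 1 / 2
  squarefree : Squarefree D

/-- The lattice `Ω_D(p,q)`. The number `r` is determined by `D, p, q`; it is carried along. -/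
noncomputable def Omega (D p r q : ℕ) : AddSubgroup Plane :=
  colLattice !![(q : ℝ), (p : ℝ); 0, (r : ℝ) * Real.sqrt (D : ℝ)]

/-- The set of integral well-rounded sublattices of `Ω_D(p₀,q₀)` similar to `Ω_D(p,q)`. -/
def iwrSublattices (D p₀ r₀ q₀ p r q : ℕ) : Set (AddSubgroup Plane) :=
  {Λ | Λ ≤ Omega D p₀ r₀ q₀ ∧ IsIntegralLattice Λ ∧ IsWellRounded Λ ∧
    SimilarLattices (Omega D p r q) Λ}

/-- The term `|Ω_D(p₀,q₀) : Λ|^{-s}`. -/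
noncomputable def zetaTerm (D p₀ r₀ q₀ : ℕ) (s : ℂ) (Λ : AddSubgroup Plane) : ℂ :=
  1 / ((Λ.relIndex (Omega D p₀ r₀ q₀) : ℕ) : ℂ) ^ s

/-- The Dirichlet series `Z_{D,p₀,q₀,p,q}(s)`. -/
noncomputable def zetaZ (D p₀ r₀ q₀ p r q : ℕ) (s : ℂ) : ℂ :=
  ∑' Λ : iwrSublattices D p₀ r₀ q₀ p r q, zetaTerm D p₀ r₀ q₀ s Λ

/-- The group of integer solutions `(x,y)` of the two congruences
`q₀ r x + (p₀ r - r₀ p) y ≡ 0` and `(p₀ r + r₀ p) x + q₀ r y ≡ 0` modulo `q r₀`. -/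
def congLattice (p₀ r₀ q₀ p r q : ℕ) : Submodule ℤ (ℤ × ℤ) where
  carrier := {v | ((q : ℤ) * r₀ ∣ q₀ * r * v.1 + ((p₀ : ℤ) * r - r₀ * p) * v.2) ∧
    ((q : ℤ) * r₀ ∣ ((p₀ : ℤ) * r + r₀ * p) * v.1 + q₀ * r * v.2)}
  add_mem' := by
    rintro ⟨x, y⟩ ⟨x', y'⟩ ⟨h1, h2⟩ ⟨h3, h4⟩
    refine ⟨(dvd_add h1 h3).trans (dvd_of_eq ?_), (dvd_add h2 h4).trans (dvd_of_eq ?_)⟩ <;>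
    · simp only [Prod.mk_add_mk]
      ring
  zero_mem' := by simp
  smul_mem' := by
    rintro c ⟨x, y⟩ ⟨h1, h2⟩
    refine ⟨(h1.mul_left c).trans (dvd_of_eq ?_), (h2.mul_left c).trans (dvd_of_eq ?_)⟩ <;>
    · simp only [Prod.smul_mk, smul_eq_mul]
      ring

/-- The value at `v = (m,n)` of the binary quadratic form `a m² + b m n + c n²`. -/
def binForm (a b c : ℤ) (v : ℤ × ℤ) : ℤ := a * v.1 ^ 2 + b * v.1 * v.2 + c * v.2 ^ 2

/-- `a m² + b m n + c n²` is the form `((x p₀ + y q₀)² + D r₀² x²) / q`, restricted to the solutions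
`(x,y)` of the two congruences and written in the coordinates of the basis `B` of this group. -/
def IsSolutionForm (D p₀ r₀ q₀ p r q : ℕ)
    (B : Module.Basis (Fin 2) ℤ (congLattice p₀ r₀ q₀ p r q)) (a b c : ℤ) : Prop :=
  ∀ m n x y : ℤ, ((m • B 0 + n • B 1 : congLattice p₀ r₀ q₀ p r q) : ℤ × ℤ) = (x, y) →
    (q : ℤ) * binForm a b c (m, n) = (x * p₀ + y * q₀) ^ 2 + D * r₀ ^ 2 * x ^ 2

/-- The term `Q(v)^{-s}` of the Epstein zeta-function of `Q = a m² + b m n + c n²`. -/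
noncomputable def epsteinTerm (a b c : ℤ) (s : ℂ) (v : ℤ × ℤ) : ℂ :=
  1 / ((binForm a b c v : ℤ) : ℂ) ^ s

/-- The Epstein zeta-function of `a m² + b m n + c n²`: a sum over nonzero integer pairs. -/
noncomputable def epsteinZeta (a b c : ℤ) (s : ℂ) : ℂ :=
  ∑' v : {v : ℤ × ℤ // v ≠ 0}, epsteinTerm a b c s v

/-! View the plane as `ℂ`. Up to scaling, `Ω_D(p,q)` is `ℤ + ℤρ` with `ρ = (p + r√-D)/q`, `|ρ| = 1`
and `0 < Re ρ ≤ 1/2`. Its similar copies are exactly the lattices `ℤu + ℤρu` with `u ≠ 0`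
(`similar_planeLattice_iff`). Such a lattice lies in `Ω₀ = Ω_D(p₀,q₀)` iff `u` and `ρu` do, which
for the coordinates `(x,y)` of `u` is the pair of congruences defining `L`; integrality and
well-roundedness are then automatic (`mem_iwrSublattices_iff`).

Comparing areas, the index of `ℤu + ℤρu` is `r|u|²/(q r₀ q₀)`. As `u` and `ρu` have integral inner
product `(p/q)|u|²` and `gcd(p,q) = 1`, the norm `|u|²` is `qQ` with `Q` an integral form on `L`.
Each sublattice comes from `w` choices of `u`, where `w` counts the `e` with `e(ℤ + ℤρ) = ℤ + ℤρ`
(`planeLattice_mul_eq_iff`): six in the hexagonal case `q = 2p`, otherwise only `±1`. Summing over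
fibres gives the formula.

The analytic claims reduce to the Epstein zeta-function of `Q`. Scaled to determinant one, `Q` has a
theta series with `θ(1/t) = tθ(t)`, by Poisson summation in each variable; a Mellin transform yields
the continuation and the simple pole. -/

/-! ### Theta series of a binary form of determinant one. -/

/-- The real binary quadratic form `A m² + 2 B m n + C n²`. -/
def realForm (A B C : ℝ) (v : ℤ × ℤ) : ℝ := A * v.1 ^ 2 + 2 * B * v.1 * v.2 + C * v.2 ^ 2

/-- The Gram matrix `M` has determinant 1, so Cayley–Hamilton gives `tr(M) M - 1 = M²`, and the
difference of the two sides is `|Mv|²` up to the factor `A + C`. -/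
lemma realForm_lower_bound {A B C : ℝ} (hA : 0 < A) (hC : 0 < C) (h : A * C - B ^ 2 = 1)
    (v : ℤ × ℤ) : (A + C)⁻¹ * ((v.1 : ℝ) ^ 2 + (v.2 : ℝ) ^ 2) ≤ realForm A B C v := by
  rw [inv_mul_le_iff₀ (by positivity), realForm]
  have : (A + C) * (A * v.1 ^ 2 + 2 * B * v.1 * v.2 + C * v.2 ^ 2) - ((v.1 : ℝ) ^ 2 + v.2 ^ 2)
      = (A * v.1 + B * v.2) ^ 2 + (B * v.1 + C * v.2) ^ 2 := by
    linear_combination (v.1 ^ 2 + v.2 ^ 2 : ℝ) * h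
  nlinarith [sq_nonneg (A * v.1 + B * v.2), sq_nonneg (B * v.1 + C * v.2)]

lemma one_le_sq_add_sq {v : ℤ × ℤ} (hv : v ≠ 0) : 1 ≤ (v.1 : ℝ) ^ 2 + (v.2 : ℝ) ^ 2 := by
  have h : (0 : ℤ) < v.1 ^ 2 + v.2 ^ 2 := by
    rcases eq_or_ne v.1 0 with h1 | h1
    · have h2 : v.2 ≠ 0 := fun h2 => hv (Prod.ext h1 h2)
      positivity
    · positivity
  exact_mod_cast h

lemma realForm_ge {A B C : ℝ} (hA : 0 < A) (hC : 0 < C) (h : A * C - B ^ 2 = 1)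
    {v : ℤ × ℤ} (hv : v ≠ 0) : (A + C)⁻¹ ≤ realForm A B C v := by
  refine le_trans ?_ (realForm_lower_bound hA hC h v)
  exact le_mul_of_one_le_right (by positivity) (one_le_sq_add_sq hv)

lemma realForm_nonneg {A B C : ℝ} (hA : 0 < A) (hC : 0 < C) (h : A * C - B ^ 2 = 1)
    (v : ℤ × ℤ) : 0 ≤ realForm A B C v :=
  le_trans (by positivity) (realForm_lower_bound hA hC h v)

lemma summable_gaussian {t : ℝ} (ht : 0 < t) :
    Summable fun n : ℤ => Real.exp (-Real.pi * t * (n : ℝ) ^ 2) := by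
  refine (summable_pow_mul_jacobiTheta₂_term_bound 0 ht 0).congr fun n => ?_
  simp [mul_assoc]

lemma summable_gaussian_prod {s t : ℝ} (hs : 0 < s) (ht : 0 < t) :
    Summable fun v : ℤ × ℤ =>
      Real.exp (-Real.pi * s * (v.1 : ℝ) ^ 2 - Real.pi * t * (v.2 : ℝ) ^ 2) := by
  refine ((summable_gaussian hs).mul_of_nonneg (summable_gaussian ht) (fun _ => by positivity)
    (fun _ => by positivity)).congr fun v => ?_
  rw [← Real.exp_add]
  ring_nf

lemma summable_theta {A B C : ℝ} (hA : 0 < A) (hC : 0 < C) (h : A * C - B ^ 2 = 1) {t : ℝ}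
    (ht : 0 < t) : Summable fun v : ℤ × ℤ => Real.exp (-Real.pi * t * realForm A B C v) := by
  have hd : 0 < t * (A + C)⁻¹ := by positivity
  refine (summable_gaussian_prod hd hd).of_nonneg_of_le (fun _ => by positivity) fun v => ?_
  rw [Real.exp_le_exp]
  have := mul_le_mul_of_nonneg_left (realForm_lower_bound hA hC h v)
    (by positivity : 0 ≤ Real.pi * t)
  linarith

/-- The theta series of the form `A m² + 2 B m n + C n²`. -/
noncomputable def formTheta (A B C t : ℝ) : ℝ :=
  ∑' v : ℤ × ℤ, Real.exp (-Real.pi * t * realForm A B C v)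

/-- Poisson summation in `n`. The determinant condition turns the remaining coefficient `A - B²/C`
of `m²` into `1/C`; the linear term in `n` becomes a phase. -/
lemma formTheta_inner {A B C : ℝ} (hC : 0 < C) (h : A * C - B ^ 2 = 1) {t : ℝ}
    (ht : 0 < t) (m : ℤ) :
    ∑' n : ℤ, Complex.exp (-Real.pi * t * realForm A B C (m, n)) =
      1 / ((t * C : ℝ) : ℂ) ^ (1 / 2 : ℂ) * ∑' k : ℤ,
        Complex.exp (-Real.pi * (t / C : ℝ) * m ^ 2 - Real.pi * (t * C : ℝ)⁻¹ * k ^ 2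
          + 2 * Real.pi * (Complex.I * k * B / C) * m) := by
  have hC' : (C : ℂ) ≠ 0 := by exact_mod_cast hC.ne'
  have ht' : (t : ℂ) ≠ 0 := by exact_mod_cast ht.ne'
  have h' : (A : ℂ) * C - B ^ 2 = 1 := by exact_mod_cast h
  have key := Complex.tsum_exp_neg_quadratic (a := ((t * C : ℝ) : ℂ))
    (by rw [Complex.ofReal_re]; positivity) (-(t * B * m))
  have e1 : ∀ n : ℤ, Complex.exp (-Real.pi * t * realForm A B C (m, n)) =
      Complex.exp (-Real.pi * t * A * m ^ 2) * Complex.exp (-Real.pi * ((t * C : ℝ) : ℂ) * n ^ 2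
        + 2 * Real.pi * (-(t * B * m)) * n) := by
    intro n
    rw [← Complex.exp_add]
    congr 1
    simp only [realForm]
    push_cast
    ring
  rw [tsum_congr e1, tsum_mul_left, key, ← mul_assoc, mul_comm (Complex.exp _), mul_assoc,
    ← tsum_mul_left]
  congr 2
  ext k
  rw [← Complex.exp_add]
  congr 1
  push_cast
  field_simp
  ring_nf
  rw [Complex.I_sq]
  linear_combination (-(t : ℂ) ^ 2 * m ^ 2) * h'

/-- Poisson summation in `m`. The outcome is the inverse form, which for determinant one is the
original form after a swap of coordinates and a sign. -/
lemma formTheta_outer {A B C : ℝ} (hC : 0 < C) (h : A * C - B ^ 2 = 1) {t : ℝ}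
    (ht : 0 < t) (k : ℤ) :
    ∑' m : ℤ, Complex.exp (-Real.pi * (t / C : ℝ) * m ^ 2 - Real.pi * (t * C : ℝ)⁻¹ * k ^ 2
          + 2 * Real.pi * (Complex.I * k * B / C) * m) =
      1 / ((t / C : ℝ) : ℂ) ^ (1 / 2 : ℂ) * ∑' l : ℤ,
        Complex.exp (-Real.pi * (1 / t : ℝ) * realForm A B C (k, -l)) := by
  have hC' : (C : ℂ) ≠ 0 := by exact_mod_cast hC.ne'
  have ht' : (t : ℂ) ≠ 0 := by exact_mod_cast ht.ne'
  have h' : (A : ℂ) * C - B ^ 2 = 1 := by exact_mod_cast h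
  have key := Complex.tsum_exp_neg_quadratic (a := ((t / C : ℝ) : ℂ))
    (by rw [Complex.ofReal_re]; positivity) (Complex.I * k * B / C)
  have e1 : ∀ m : ℤ, Complex.exp (-Real.pi * (t / C : ℝ) * m ^ 2
        - Real.pi * (t * C : ℝ)⁻¹ * k ^ 2 + 2 * Real.pi * (Complex.I * k * B / C) * m) =
      Complex.exp (- Real.pi * (t * C : ℝ)⁻¹ * k ^ 2) *
        Complex.exp (-Real.pi * ((t / C : ℝ) : ℂ) * m ^ 2
        + 2 * Real.pi * (Complex.I * k * B / C) * m) := by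
    intro m
    rw [← Complex.exp_add]
    congr 1
    ring
  rw [tsum_congr e1, tsum_mul_left, key, ← mul_assoc, mul_comm (Complex.exp _), mul_assoc,
    ← tsum_mul_left]
  congr 2
  ext l
  rw [← Complex.exp_add]
  congr 1
  simp only [realForm]
  have hI : Complex.I * (Complex.I * k * B / C) = -(k * B / C) := by
    rw [← mul_div_assoc, ← mul_assoc, ← mul_assoc, Complex.I_mul_I]; ring
  rw [hI]
  push_cast
  field_simp
  linear_combination (k : ℂ) ^ 2 * h'

lemma formTheta_functional_equation {A B C : ℝ} (hA : 0 < A) (hC : 0 < C)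
    (h : A * C - B ^ 2 = 1) {t : ℝ} (ht : 0 < t) :
    formTheta A B C (1 / t) = t * formTheta A B C t := by
  have hsum : ∀ {u : ℝ}, 0 < u →
      Summable fun v : ℤ × ℤ => Complex.exp (-Real.pi * u * realForm A B C v) := fun hu => by
    have := Complex.ofRealCLM.summable (summable_theta hA hC h hu)
    simpa using this
  have hcast : ∀ u : ℝ, (formTheta A B C u : ℂ) =
      ∑' v : ℤ × ℤ, Complex.exp (-Real.pi * u * realForm A B C v) := fun u => by
    rw [formTheta, Complex.ofReal_tsum]
    simp
  have h1 : (formTheta A B C t : ℂ) = 1 / ((t * C : ℝ) : ℂ) ^ (1 / 2 : ℂ) *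
      ∑' m : ℤ, ∑' k : ℤ, Complex.exp (-Real.pi * (t / C : ℝ) * m ^ 2
        - Real.pi * (t * C : ℝ)⁻¹ * k ^ 2 + 2 * Real.pi * (Complex.I * k * B / C) * m) := by
    rw [hcast, (hsum ht).tsum_prod, tsum_congr (formTheta_inner hC h ht), tsum_mul_left]
  -- Exchanging the two sums needs absolute convergence; the mixed factor is a phase of modulus one,
  -- so a product of Gaussians remains.
  have hs : Summable (Function.uncurry fun m k : ℤ =>
      Complex.exp (-Real.pi * (t / C : ℝ) * m ^ 2
        - Real.pi * (t * C : ℝ)⁻¹ * k ^ 2 + 2 * Real.pi * (Complex.I * k * B / C) * m)) := by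
    refine Summable.of_norm ((summable_gaussian_prod (div_pos ht hC)
      (inv_pos.2 (mul_pos ht hC))).congr fun v => ?_)
    simp only [Function.uncurry, Complex.norm_exp]
    congr 1
    have : (-Real.pi * (t / C : ℝ) * v.1 ^ 2
        - Real.pi * (t * C : ℝ)⁻¹ * v.2 ^ 2 + 2 * Real.pi * (Complex.I * v.2 * B / C) * v.1 : ℂ) =
        ((-Real.pi * (t / C) * v.1 ^ 2 - Real.pi * (t * C)⁻¹ * v.2 ^ 2 : ℝ) : ℂ) +
        ((2 * Real.pi * (v.2 * B / C) * v.1 : ℝ) : ℂ) * Complex.I := by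
      push_cast; ring
    rw [this, Complex.add_re, Complex.ofReal_re, Complex.re_ofReal_mul, Complex.I_re, mul_zero,
      add_zero]
  rw [← hs.tsum_comm, tsum_congr (formTheta_outer hC h ht), tsum_mul_left] at h1
  have h2 : ∑' k : ℤ, ∑' l : ℤ, Complex.exp (-Real.pi * (1 / t : ℝ) * realForm A B C (k, -l)) =
      formTheta A B C (1 / t) := by
    rw [hcast, (hsum (one_div_pos.2 ht)).tsum_prod]
    refine tsum_congr fun k => ?_
    exact (Equiv.neg ℤ).tsum_eq fun l => Complex.exp (-Real.pi * (1 / t : ℝ) * realForm A B C (k, l))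
  rw [h2, ← mul_assoc] at h1
  have h3 : (1 / ((t * C : ℝ) : ℂ) ^ (1 / 2 : ℂ)) * (1 / ((t / C : ℝ) : ℂ) ^ (1 / 2 : ℂ)) =
      (t : ℂ)⁻¹ := by
    have ht' : (t : ℂ) ≠ 0 := by exact_mod_cast ht.ne'
    rw [div_mul_div_comm, one_mul, ← Complex.mul_cpow_ofReal_nonneg (by positivity) (by positivity),
      ← Complex.ofReal_mul, show t * C * (t / C) = t * t by field_simp, Complex.ofReal_mul,
      Complex.mul_cpow_ofReal_nonneg ht.le ht.le, ← Complex.cpow_add _ _ ht']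
    norm_num
  rw [h3] at h1
  have h4 : (formTheta A B C (1 / t) : ℂ) = t * formTheta A B C t := by
    have ht' : (t : ℂ) ≠ 0 := by exact_mod_cast ht.ne'
    rw [h1]
    field_simp
  exact_mod_cast h4

lemma hasSum_formTheta_sub_one {A B C : ℝ} (hA : 0 < A) (hC : 0 < C) (h : A * C - B ^ 2 = 1)
    {t : ℝ} (ht : 0 < t) :
    HasSum (fun v : {v : ℤ × ℤ // v ≠ 0} => Real.exp (-Real.pi * t * realForm A B C v))
      (formTheta A B C t - 1) := by
  have h1 := (summable_theta hA hC h ht).hasSum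
  have h0 : Real.exp (-Real.pi * t * realForm A B C 0) = 1 := by simp [realForm]
  have h2 := h1.sub (hasSum_ite_eq (0 : ℤ × ℤ) (1 : ℝ))
  refine ((hasSum_subtype_iff_indicator (s := {v : ℤ × ℤ | v ≠ 0})).2
    ?_ : HasSum ((fun v : ℤ × ℤ => Real.exp (-Real.pi * t * realForm A B C v)) ∘
      ((↑) : {v : ℤ × ℤ | v ≠ 0} → ℤ × ℤ)) _)
  change HasSum _ ((∑' v : ℤ × ℤ, Real.exp (-Real.pi * t * realForm A B C v)) - 1)
  convert! h2 using 2 with v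
  by_cases hv : v = 0
  · subst hv; rw [h0]; simp
  · simp [Set.indicator, hv]

lemma formTheta_antitoneOn {A B C : ℝ} (hA : 0 < A) (hC : 0 < C) (h : A * C - B ^ 2 = 1) :
    AntitoneOn (formTheta A B C) (Set.Ioi 0) := by
  intro s hs t ht hst
  refine (summable_theta hA hC h ht).tsum_le_tsum (fun v => ?_) (summable_theta hA hC h hs)
  rw [Real.exp_le_exp]
  have := realForm_nonneg hA hC h v
  have := mul_le_mul_of_nonneg_right hst (mul_nonneg Real.pi_pos.le this)
  linarith

lemma formTheta_sub_one_isBigO {A B C : ℝ} (hA : 0 < A) (hC : 0 < C) (h : A * C - B ^ 2 = 1)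
    (r : ℝ) : (fun t => formTheta A B C t - 1) =O[Filter.atTop] (fun t => t ^ r) := by
  have hd : 0 < Real.pi * (A + C)⁻¹ := by positivity
  refine Asymptotics.IsBigO.trans ?_ (isLittleO_exp_neg_mul_rpow_atTop hd r).isBigO
  refine Asymptotics.IsBigO.of_bound
    (Real.exp (Real.pi * (A + C)⁻¹) * (formTheta A B C 1 - 1)) ?_
  filter_upwards [Filter.eventually_ge_atTop 1] with t ht
  have h1 := hasSum_formTheta_sub_one hA hC h one_pos
  have h2 := hasSum_formTheta_sub_one hA hC h (lt_of_lt_of_le one_pos ht)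
  rw [Real.norm_of_nonneg (h2.nonneg fun _ => by positivity), Real.norm_of_nonneg (by positivity)]
  -- For `t ≥ 1` and `v ≠ 0` the form is at least `(A + C)⁻¹`, so passing from time 1 to time `t`
  -- costs each term a factor of at most `exp(-π(t - 1)/(A + C))`.
  have h3 := h1.mul_left (Real.exp (Real.pi * (A + C)⁻¹) *
    Real.exp (-(Real.pi * (A + C)⁻¹) * t))
  calc _ ≤ _ := hasSum_le (fun v => ?_) h2 h3
    _ = _ := by ring
  rw [← Real.exp_add, ← Real.exp_add, Real.exp_le_exp]
  have := mul_le_mul_of_nonneg_left (realForm_ge hA hC h v.2)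
    (mul_nonneg Real.pi_pos.le (sub_nonneg.2 ht))
  linarith

/-! ### Mellin transform and continuation of the Epstein zeta-function. -/

/-- The theta series of a form with `A C - B² = 1` is self-dual of weight one. -/
noncomputable def formFEPair {A B C : ℝ} (hA : 0 < A) (hC : 0 < C) (h : A * C - B ^ 2 = 1) :
    WeakFEPair ℂ :=
  have hint : MeasureTheory.LocallyIntegrableOn (fun t => (formTheta A B C t : ℂ)) (Set.Ioi 0) := by
    rw [MeasureTheory.locallyIntegrableOn_iff isOpen_Ioi.isLocallyClosed]
    intro K hK hKc
    exact (((formTheta_antitoneOn hA hC h).mono hK).integrableOn_isCompact hKc).ofReal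
  have htop (r : ℝ) : (fun t => (formTheta A B C t : ℂ) - 1) =O[Filter.atTop] (fun t => t ^ r) := by
    refine Asymptotics.IsBigO.congr_left
      (Asymptotics.isBigO_norm_left.1 ((formTheta_sub_one_isBigO hA hC h r).norm_left.congr_left
        fun t => ?_)) fun t => rfl
    rw [← Complex.norm_real]
    push_cast
    rfl
  { f := fun t => (formTheta A B C t : ℂ)
    g := fun t => (formTheta A B C t : ℂ)
    k := 1
    ε := 1
    f₀ := 1
    g₀ := 1
    hf_int := hint
    hg_int := hint
    hk := one_pos
    hε := one_ne_zero
    h_feq := fun x hx => by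
      rw [formTheta_functional_equation hA hC h hx]
      simp
    hf_top := htop
    hg_top := htop }

lemma summable_realForm_rpow {A B C : ℝ} (hA : 0 < A) (hC : 0 < C) (h : A * C - B ^ 2 = 1)
    {σ : ℝ} (hσ : 1 < σ) :
    Summable fun v : {v : ℤ × ℤ // v ≠ 0} => (realForm A B C v ^ σ)⁻¹ := by
  have h1 := EisensteinSeries.summable_one_div_norm_rpow (k := 2 * σ) (by linarith)
  rw [← (finTwoArrowEquiv ℤ).symm.summable_iff] at h1
  have h2 := (h1.subtype {v : ℤ × ℤ | v ≠ 0}).mul_left (((A + C)⁻¹ ^ σ)⁻¹)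
  refine Summable.of_nonneg_of_le (fun v => ?_) (fun v => ?_) h2
  · exact inv_nonneg.2 (Real.rpow_nonneg (realForm_nonneg hA hC h _) _)
  · have hv : ((finTwoArrowEquiv ℤ).symm v.1) ≠ 0 := fun h0 => v.2 (by
      have := congrArg (finTwoArrowEquiv ℤ) h0
      rw [Equiv.apply_symm_apply] at this
      exact this)
    have hpos : 0 < ‖(finTwoArrowEquiv ℤ).symm v.1‖ := norm_pos_iff.2 hv
    have hle : (A + C)⁻¹ * ‖(finTwoArrowEquiv ℤ).symm v.1‖ ^ 2 ≤ realForm A B C v := by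
      refine le_trans ?_ (realForm_lower_bound hA hC h _)
      refine mul_le_mul_of_nonneg_left ?_ (by positivity)
      rw [EisensteinSeries.norm_eq_max_natAbs]
      simp only [finTwoArrowEquiv_symm_apply, Matrix.cons_val_zero, Matrix.cons_val_one]
      rcases le_total v.1.1.natAbs v.1.2.natAbs with h | h
      · rw [max_eq_right h, Nat.cast_natAbs, Int.cast_abs, sq_abs]
        exact le_add_of_nonneg_left (sq_nonneg _)
      · rw [max_eq_left h, Nat.cast_natAbs, Int.cast_abs, sq_abs]
        exact le_add_of_nonneg_right (sq_nonneg _)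
    have hAC : 0 < (A + C)⁻¹ := by positivity
    calc (realForm A B C v ^ σ)⁻¹
        ≤ (((A + C)⁻¹ * ‖(finTwoArrowEquiv ℤ).symm v.1‖ ^ 2) ^ σ)⁻¹ := by
          gcongr
      _ = _ := by
          rw [Real.mul_rpow hAC.le (by positivity), mul_inv, ← Real.rpow_natCast,
            ← Real.rpow_mul hpos.le, Function.comp_apply, Function.comp_apply,
            Real.rpow_neg hpos.le]
          norm_num

/-- `(s - 1) Z(s)` for the Epstein zeta-function `Z` of the form `A m² + 2 B m n + C n²` with
`A C - B² = 1`. -/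
noncomputable def formEntire {A B C : ℝ} (hA : 0 < A) (hC : 0 < C) (h : A * C - B ^ 2 = 1)
    (s : ℂ) : ℂ :=
  (Real.pi : ℂ) ^ s * ((s - 1) * ((Complex.Gamma s)⁻¹ * (formFEPair hA hC h).Λ₀ s)
    + (Complex.Gamma s)⁻¹ - (s - 1) * (Complex.Gamma (s + 1))⁻¹)

/-- Only `1/Γ` and `Λ₀`, both entire, occur: writing `1/(sΓ(s))` as `1/Γ(s + 1)` removes the
apparent pole at 0. -/
lemma differentiable_formEntire {A B C : ℝ} (hA : 0 < A) (hC : 0 < C) (h : A * C - B ^ 2 = 1) :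
    Differentiable ℂ (formEntire hA hC h) := by
  have h1 := Complex.differentiable_one_div_Gamma
  have h2 : Differentiable ℂ fun s : ℂ => (Complex.Gamma (s + 1))⁻¹ :=
    h1.comp (differentiable_id.add_const 1)
  have h3 := (formFEPair hA hC h).differentiable_Λ₀
  have h4 : Differentiable ℂ fun s : ℂ => (Real.pi : ℂ) ^ s := fun s =>
    DifferentiableAt.const_cpow differentiableAt_id (Or.inl (by exact_mod_cast Real.pi_ne_zero))
  unfold formEntire
  fun_prop

lemma formEntire_one {A B C : ℝ} (hA : 0 < A) (hC : 0 < C) (h : A * C - B ^ 2 = 1) :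
    formEntire hA hC h 1 = Real.pi := by
  simp [formEntire]

/-- Integrating `θ - 1` termwise against `t^(s-1)` gives `π^(-s) Γ(s)` times the zeta-function; the
functional equation identifies the same integral with `Λ₀(s) - 1/s - 1/(1 - s)`. -/
lemma hasSum_formEntire {A B C : ℝ} (hA : 0 < A) (hC : 0 < C) (h : A * C - B ^ 2 = 1)
    {s : ℂ} (hs : 1 < s.re) :
    HasSum (fun v : {v : ℤ × ℤ // v ≠ 0} => 1 / (realForm A B C v : ℂ) ^ s)
      ((s - 1)⁻¹ * formEntire hA hC h s) := by
  have hs0 : 0 < s.re := by linarith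
  have hne : s ≠ 0 := by rintro rfl; simp at hs0
  have hne1 : s - 1 ≠ 0 := by
    intro h0; rw [sub_eq_zero.1 h0] at hs; simp at hs
  have hG : Complex.Gamma s ≠ 0 := Complex.Gamma_ne_zero_of_re_pos hs0
  have hpi : (Real.pi : ℂ) ≠ 0 := by exact_mod_cast Real.pi_ne_zero
  have hmel := ((formFEPair hA hC h).hasMellin (s := s) hs).2
  have key := hasSum_mellin_pi_mul (ι := {v : ℤ × ℤ // v ≠ 0}) (a := fun _ => 1)
    (q := fun v => realForm A B C v) (F := fun t => (formTheta A B C t : ℂ) - 1) (s := s)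
    (fun v => Or.inr (lt_of_lt_of_le (by positivity) (realForm_ge hA hC h v.2))) hs0
    (fun t ht => by
      have := Complex.hasSum_ofReal.2 (hasSum_formTheta_sub_one hA hC h ht)
      simpa only [one_mul, Complex.ofReal_sub, Complex.ofReal_one, mul_right_comm _ t] using this)
    (by simpa using summable_realForm_rpow hA hC h hs)
  have hΛ : mellin (fun t => (formTheta A B C t : ℂ) - 1) s =
      (formFEPair hA hC h).Λ₀ s - 1 / s - 1 / (1 - s) := by
    refine hmel.trans ?_
    simp [WeakFEPair.Λ, formFEPair]
  rw [hΛ] at key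
  have hpis : (Real.pi : ℂ) ^ s ≠ 0 := by simp [Complex.cpow_eq_zero_iff, hpi]
  convert! key.mul_left ((Real.pi : ℂ) ^ s * (Complex.Gamma s)⁻¹) using 1
  · ext v
    rw [Complex.cpow_neg]
    field_simp
  · have h1s : 1 - s ≠ 0 := fun h0 => hne1 (by linear_combination -h0)
    rw [formEntire, Complex.Gamma_add_one s hne]
    field_simp
    ring

lemma exists_realForm_eq_binForm {a b c : ℤ} (hpos : ∀ v : ℤ × ℤ, v ≠ 0 → 0 < binForm a b c v) :
    ∃ κ A B C : ℝ, 0 < κ ∧ 0 < A ∧ 0 < C ∧ A * C - B ^ 2 = 1 ∧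
      ∀ v, realForm A B C v = κ * binForm a b c v := by
  have ha : 0 < a := by simpa [binForm] using hpos (1, 0) (by simp)
  have hc : 0 < c := by simpa [binForm] using hpos (0, 1) (by simp)
  have hd : 0 < 4 * a * c - b ^ 2 := by
    -- The value of the form at this vector is `a(4ac - b²)`.
    have h1 := hpos (b, -2 * a) (by simp [ha.ne'])
    simp only [binForm] at h1
    refine pos_of_mul_pos_right (a := a) ?_ ha.le
    linarith
  have hd' : (0 : ℝ) < 4 * a * c - b ^ 2 := by exact_mod_cast hd
  have ha' : (0 : ℝ) < a := by exact_mod_cast ha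
  have hc' : (0 : ℝ) < c := by exact_mod_cast hc
  have hs := Real.sqrt_pos.2 hd'
  have hsq := Real.sq_sqrt hd'.le
  set e := √(4 * a * c - b ^ 2 : ℝ)
  refine ⟨2 / e, 2 / e * a, b / e, 2 / e * c, by positivity, by positivity, by positivity, ?_,
    fun v => ?_⟩
  · field_simp
    linarith
  · simp only [realForm, binForm]
    push_cast
    field_simp

/-- The Epstein zeta-function of a positive definite integral binary quadratic form converges
absolutely for `1 < Re s` and continues to the plane with a simple pole at `1`. -/
theorem epsteinZeta_continuation {a b c : ℤ}
    (hpos : ∀ v : ℤ × ℤ, v ≠ 0 → 0 < binForm a b c v) :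
    ∃ G : ℂ → ℂ, Differentiable ℂ G ∧ G 1 ≠ 0 ∧ ∀ s : ℂ, 1 < s.re →
      (Summable fun v : {v : ℤ × ℤ // v ≠ 0} => ‖epsteinTerm a b c s v‖) ∧
      epsteinZeta a b c s = (s - 1)⁻¹ * G s := by
  obtain ⟨κ, A, B, C, hκ, hA, hC, h, hform⟩ := exists_realForm_eq_binForm hpos
  have hκ' : (κ : ℂ) ≠ 0 := by exact_mod_cast hκ.ne'
  refine ⟨fun s => (κ : ℂ) ^ s * formEntire hA hC h s, ?_, ?_, fun s hs => ?_⟩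
  · refine Differentiable.mul (fun s => ?_) (differentiable_formEntire hA hC h)
    exact DifferentiableAt.const_cpow differentiableAt_id (Or.inl hκ')
  · simp [formEntire_one, hκ', Real.pi_ne_zero]
  · have hsum : HasSum (fun v : {v : ℤ × ℤ // v ≠ 0} => epsteinTerm a b c s v)
        ((s - 1)⁻¹ * ((κ : ℂ) ^ s * formEntire hA hC h s)) := by
      convert! (hasSum_formEntire hA hC h hs).mul_left ((κ : ℂ) ^ s) using 1
      · ext v
        have hb : (0 : ℝ) ≤ (binForm a b c v : ℤ) := by exact_mod_cast (hpos v v.2).le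
        have hκs : (κ : ℂ) ^ s ≠ 0 := by simp [Complex.cpow_eq_zero_iff, hκ']
        rw [hform, Complex.ofReal_mul, Complex.mul_cpow_ofReal_nonneg hκ.le hb,
          Complex.ofReal_intCast, epsteinTerm]
        field_simp
      · ring
    exact ⟨summable_norm_iff.2 hsum.summable, hsum.tsum_eq⟩

/-! ### Planar lattices spanned by two complex numbers. -/

/-- The standard isometry of `ℂ` with the Euclidean plane. -/
noncomputable abbrev complexPlane : ℂ ≃ₗᵢ[ℝ] Plane := Complex.orthonormalBasisOneI.repr

/-- The planar lattice spanned by two complex numbers. -/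
noncomputable def planeLattice (u v : ℂ) : AddSubgroup Plane :=
  colLattice !![u.re, v.re; u.im, v.im]

/-- The oriented area of the parallelogram spanned by two complex numbers. -/
def cross (u v : ℂ) : ℝ := u.re * v.im - u.im * v.re

lemma planeLattice_col_zero (u v : ℂ) :
    (WithLp.toLp 2 fun i => !![u.re, v.re; u.im, v.im] i 0 : Plane) = complexPlane u := by
  ext i
  fin_cases i <;> simp

lemma planeLattice_col_one (u v : ℂ) :
    (WithLp.toLp 2 fun i => !![u.re, v.re; u.im, v.im] i 1 : Plane) = complexPlane v := by
  ext i
  fin_cases i <;> simp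

lemma planeLattice_eq_closure (u v : ℂ) :
    planeLattice u v = AddSubgroup.closure {complexPlane u, complexPlane v} := by
  rw [planeLattice, colLattice]
  congr 1
  ext x
  simp only [Set.mem_range, Fin.exists_fin_two, planeLattice_col_zero, planeLattice_col_one,
    Set.mem_insert_iff, Set.mem_singleton_iff, eq_comm]

lemma mem_planeLattice {u v : ℂ} {x : Plane} :
    x ∈ planeLattice u v ↔ ∃ m n : ℤ, x = complexPlane (m * u + n * v) := by
  rw [planeLattice_eq_closure, AddSubgroup.mem_closure_pair]
  simp only [← map_zsmul, ← map_add, zsmul_eq_mul, eq_comm]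

lemma complexPlane_mem_planeLattice {u v z : ℂ} :
    complexPlane z ∈ planeLattice u v ↔ ∃ m n : ℤ, z = m * u + n * v := by
  simp only [mem_planeLattice, complexPlane.injective.eq_iff]

lemma left_mem_planeLattice (u v : ℂ) : complexPlane u ∈ planeLattice u v :=
  complexPlane_mem_planeLattice.2 ⟨1, 0, by simp⟩

lemma right_mem_planeLattice (u v : ℂ) : complexPlane v ∈ planeLattice u v :=
  complexPlane_mem_planeLattice.2 ⟨0, 1, by simp⟩

lemma planeLattice_le_iff {u v : ℂ} {Λ : AddSubgroup Plane} :
    planeLattice u v ≤ Λ ↔ complexPlane u ∈ Λ ∧ complexPlane v ∈ Λ := by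
  rw [planeLattice_eq_closure, AddSubgroup.closure_le, Set.insert_subset_iff,
    Set.singleton_subset_iff]
  rfl

lemma det_planeLattice (u v : ℂ) : (!![u.re, v.re; u.im, v.im] : Matrix _ _ ℝ).det = cross u v := by
  rw [Matrix.det_fin_two_of, cross]
  ring

lemma eq_zero_of_cross_ne_zero {u v : ℂ} (h : cross u v ≠ 0) {m n : ℝ}
    (h0 : m * u + n * v = 0) : m = 0 ∧ n = 0 := by
  have h1 := congrArg Complex.re h0
  have h2 := congrArg Complex.im h0
  simp only [Complex.add_re, Complex.add_im, Complex.re_ofReal_mul, Complex.im_ofReal_mul,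
    Complex.zero_re, Complex.zero_im] at h1 h2
  unfold cross at h
  constructor
  · refine (mul_eq_zero.1 ?_).resolve_right h
    linear_combination v.im * h1 - v.re * h2
  · refine (mul_eq_zero.1 ?_).resolve_right h
    linear_combination u.re * h2 - u.im * h1

lemma eq_of_cross_ne_zero {u v : ℂ} (h : cross u v ≠ 0) {m n m' n' : ℤ}
    (h0 : (m : ℂ) * u + n * v = m' * u + n' * v) : m = m' ∧ n = n' := by
  have := eq_zero_of_cross_ne_zero h (m := m - m') (n := n - n') (by
    push_cast; linear_combination h0)
  constructor
  · exact_mod_cast sub_eq_zero.1 this.1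
  · exact_mod_cast sub_eq_zero.1 this.2

lemma exists_basis_planeLattice {u v : ℂ} (h : cross u v ≠ 0) :
    ∃ b : Module.Basis (Fin 2) ℤ (AddSubgroup.toIntSubmodule (planeLattice u v)),
      (b 0 : Plane) = complexPlane u ∧ (b 1 : Plane) = complexPlane v := by
  let f : Fin 2 → AddSubgroup.toIntSubmodule (planeLattice u v) :=
    ![⟨complexPlane u, left_mem_planeLattice u v⟩, ⟨complexPlane v, right_mem_planeLattice u v⟩]
  have hli : LinearIndependent ℤ f := by
    rw [LinearIndependent.pair_iff]
    intro m n h0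
    have h1 := congrArg Subtype.val h0
    simp only [Submodule.coe_add, Submodule.coe_smul, Submodule.coe_zero, ← map_zsmul, ← map_add,
      zsmul_eq_mul, map_eq_zero_iff _ complexPlane.injective] at h1
    exact eq_of_cross_ne_zero h (m' := 0) (n' := 0) (by simpa using h1)
  have hsp : ⊤ ≤ Submodule.span ℤ (Set.range f) := by
    rintro ⟨x, hx⟩ -
    obtain ⟨m, n, rfl⟩ := mem_planeLattice.1 hx
    have : (⟨_, hx⟩ : AddSubgroup.toIntSubmodule (planeLattice u v)) = m • f 0 + n • f 1 := by
      ext1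
      simp only [f, Submodule.coe_add, Submodule.coe_smul, Matrix.cons_val_zero,
        Matrix.cons_val_one, ← map_zsmul, ← map_add, zsmul_eq_mul]
    rw [this]
    exact add_mem (Submodule.smul_mem _ _ (Submodule.subset_span ⟨0, rfl⟩))
      (Submodule.smul_mem _ _ (Submodule.subset_span ⟨1, rfl⟩))
  exact ⟨Module.Basis.mk hli hsp, by rw [Module.Basis.mk_apply]; rfl,
    by rw [Module.Basis.mk_apply]; rfl⟩

/-- The index is the absolute determinant of the transition matrix, which is also the ratio of the
areas. -/
lemma relIndex_planeLattice {u v u₀ v₀ : ℂ} (h : cross u v ≠ 0) (h₀ : cross u₀ v₀ ≠ 0)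
    (hle : planeLattice u v ≤ planeLattice u₀ v₀) :
    ((planeLattice u v).relIndex (planeLattice u₀ v₀) : ℝ) * |cross u₀ v₀| = |cross u v| := by
  obtain ⟨b, hb0, hb1⟩ := exists_basis_planeLattice h
  obtain ⟨b₀, hb₀0, hb₀1⟩ := exists_basis_planeLattice h₀
  obtain ⟨m, n, hu⟩ := complexPlane_mem_planeLattice.1 (planeLattice_le_iff.1 hle).1
  obtain ⟨k, l, hv⟩ := complexPlane_mem_planeLattice.1 (planeLattice_le_iff.1 hle).2
  rw [AddSubgroup.relIndex_eq_natAbs_det _ _ hle b b₀]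
  have e0 : (⟨(b 0 : Plane), hle (SetLike.coe_mem _)⟩ :
      AddSubgroup.toIntSubmodule (planeLattice u₀ v₀)) = m • b₀ 0 + n • b₀ 1 := by
    ext1
    simp only [Submodule.coe_add, Submodule.coe_smul, hb0, hb₀0, hb₀1, hu, ← map_zsmul, ← map_add,
      zsmul_eq_mul]
  have e1 : (⟨(b 1 : Plane), hle (SetLike.coe_mem _)⟩ :
      AddSubgroup.toIntSubmodule (planeLattice u₀ v₀)) = k • b₀ 0 + l • b₀ 1 := by
    ext1
    simp only [Submodule.coe_add, Submodule.coe_smul, hb1, hb₀0, hb₀1, hv, ← map_zsmul, ← map_add,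
      zsmul_eq_mul]
  have hdet : b₀.det (fun i ↦ ⟨b i, hle (SetLike.coe_mem _)⟩) = m * l - n * k := by
    rw [Module.Basis.det_apply, Matrix.det_fin_two]
    simp only [Module.Basis.toMatrix_apply, e0, e1]
    simp
    ring
  rw [hdet, Nat.cast_natAbs, Int.cast_abs, ← abs_mul]
  congr 1
  rw [hu, hv]
  simp [cross]
  ring

/-! ### Well-rounded lattices, their similarity classes and units. -/

/-- The hypotheses on the ratio of the two shortest basis vectors of a well-rounded lattice. -/
structure IsWellRoundedRatio (ρ : ℂ) : Prop where
  normSq_eq : ρ.re ^ 2 + ρ.im ^ 2 = 1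
  re_pos : 0 < ρ.re
  re_le : ρ.re ≤ 1 / 2
  im_pos : 0 < ρ.im

namespace IsWellRoundedRatio

variable {ρ : ℂ}

lemma sq_eq (h : IsWellRoundedRatio ρ) : ρ * ρ = (2 * ρ.re : ℝ) * ρ - 1 := by
  have := h.normSq_eq
  apply Complex.ext
  · simp; linarith
  · simp; ring

lemma mul_conj (h : IsWellRoundedRatio ρ) : ρ * (starRingEnd ℂ) ρ = 1 := by
  rw [Complex.mul_conj, Complex.normSq_apply, ← sq, ← sq, h.normSq_eq, Complex.ofReal_one]

lemma cross_mul (u : ℂ) : cross u (ρ * u) = Complex.normSq u * ρ.im := by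
  simp [cross, Complex.normSq_apply]
  ring

lemma cross_pos (h : IsWellRoundedRatio ρ) {u : ℂ} (hu : u ≠ 0) : 0 < cross u (ρ * u) := by
  rw [cross_mul]
  exact mul_pos (Complex.normSq_pos.2 hu) h.im_pos

lemma normSq_combination (h : IsWellRoundedRatio ρ) (m n : ℤ) :
    Complex.normSq (m + n * ρ) = m ^ 2 + 2 * ρ.re * m * n + n ^ 2 := by
  simp [Complex.normSq_apply]
  linear_combination (n : ℝ) ^ 2 * h.normSq_eq

lemma one_le_normSq (h : IsWellRoundedRatio ρ) {m n : ℤ} (hmn : m ≠ 0 ∨ n ≠ 0) :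
    1 ≤ Complex.normSq (m + n * ρ) := by
  rw [h.normSq_combination]
  -- If `mn ≥ 0`, the cross term can be dropped; if `mn ≤ 0`, the bound `2 Re ρ ≤ 1` leaves at least
  -- `m² + mn + n²`.
  rcases le_total 0 (m * n) with h1 | h1
  · have h2 : (0 : ℝ) ≤ m * n := by exact_mod_cast h1
    have h3 : (1 : ℝ) ≤ m ^ 2 + n ^ 2 := by
      have : (0 : ℤ) < m ^ 2 + n ^ 2 := by rcases hmn with h | h <;> positivity
      exact_mod_cast this
    nlinarith [mul_nonneg h.re_pos.le h2]
  · have h2 : (m * n : ℝ) ≤ 0 := by exact_mod_cast h1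
    have h3 : (1 : ℝ) ≤ m ^ 2 + m * n + n ^ 2 := by
      have : (0 : ℤ) < m ^ 2 + m * n + n ^ 2 := by
        rcases hmn with h | h
        · have : 0 < m ^ 2 := by positivity
          nlinarith [sq_nonneg (m + 2 * n)]
        · have : 0 < n ^ 2 := by positivity
          nlinarith [sq_nonneg (2 * m + n)]
      exact_mod_cast this
    nlinarith [h.re_le]

lemma isMinimalVector (h : IsWellRoundedRatio ρ) {u x : ℂ} (hu : u ≠ 0)
    (hx : complexPlane x ∈ planeLattice u (ρ * u)) (hnorm : ‖x‖ = ‖u‖) :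
    IsMinimalVector (planeLattice u (ρ * u)) (complexPlane x) := by
  refine ⟨hx, ?_, fun y hy hy0 => ?_⟩
  · rw [Ne, map_eq_zero_iff _ complexPlane.injective, ← norm_eq_zero, hnorm, norm_eq_zero]
    exact hu
  · obtain ⟨m, n, rfl⟩ := mem_planeLattice.1 hy
    have hmn : m ≠ 0 ∨ n ≠ 0 := by
      by_contra! h0
      simp [h0.1, h0.2] at hy0
    rw [LinearIsometryEquiv.norm_map, LinearIsometryEquiv.norm_map, hnorm,
      show (m : ℂ) * u + n * (ρ * u) = (m + n * ρ) * u by ring, norm_mul, mul_pow,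
      ← Complex.normSq_eq_norm_sq (m + n * ρ)]
    exact le_mul_of_one_le_left (sq_nonneg _) (h.one_le_normSq hmn)

lemma norm_eq_one (h : IsWellRoundedRatio ρ) : ‖ρ‖ = 1 := by
  rw [← sq_eq_sq₀ (norm_nonneg _) zero_le_one, ← Complex.normSq_eq_norm_sq, Complex.normSq_apply]
  linarith [h.normSq_eq]

lemma isWellRounded (h : IsWellRoundedRatio ρ) {u : ℂ} (hu : u ≠ 0) :
    IsWellRounded (planeLattice u (ρ * u)) := by
  refine ⟨!![u.re, (ρ * u).re; u.im, (ρ * u).im],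
    ⟨by rw [det_planeLattice]; exact (h.cross_pos hu).ne', rfl⟩, fun j => ?_⟩
  fin_cases j
  · simp only [Fin.zero_eta, planeLattice_col_zero]
    exact h.isMinimalVector hu (left_mem_planeLattice _ _) rfl
  · simp only [Fin.mk_one, planeLattice_col_one]
    exact h.isMinimalVector hu (right_mem_planeLattice _ _) (by rw [norm_mul, h.norm_eq_one, one_mul])

end IsWellRoundedRatio

lemma coe_planeLattice (u v : ℂ) : (planeLattice u v : Set Plane) =
    Set.range fun k : ℤ × ℤ => complexPlane (k.1 * u + k.2 * v) := by
  ext x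
  simp [mem_planeLattice, eq_comm]

lemma similar_planeLattice_iff {ρ : ℂ} (h : IsWellRoundedRatio ρ) {q : ℝ} (hq : 0 < q)
    {Λ : AddSubgroup Plane} :
    SimilarLattices (planeLattice q (ρ * q)) Λ ↔ ∃ u : ℂ, u ≠ 0 ∧ Λ = planeLattice u (ρ * u) := by
  have hq' : (q : ℂ) ≠ 0 := by exact_mod_cast hq.ne'
  constructor
  · rintro ⟨α, hα, U, hU⟩
    have hα' : (α : ℂ) ≠ 0 := by exact_mod_cast hα.ne'
    have hU' : ∀ z, α • U (complexPlane z) =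
        complexPlane (α * ((complexPlane.trans U).trans complexPlane.symm) z) := fun z => by
      rw [← Complex.real_smul, map_smul, LinearIsometryEquiv.trans_apply,
        LinearIsometryEquiv.trans_apply, LinearIsometryEquiv.apply_symm_apply]
    rw [coe_planeLattice, ← Set.range_comp] at hU
    obtain ⟨a, ha | ha⟩ := linear_isometry_complex ((complexPlane.trans U).trans complexPlane.symm)
    · refine ⟨α * (a * q), by simp [hα', hq'], SetLike.coe_injective ?_⟩
      rw [hU, coe_planeLattice]
      congr 1
      ext1 k
      simp only [Function.comp_apply]
      rw [hU', ha, rotation_apply]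
      congr 1
      ring
    -- An orientation-reversing isometry gives no new lattice: since `ρ·conj ρ = 1`, the pair `(1,
    -- conj ρ)` is `(ρw, w)` with `w = conj ρ`, so swapping the basis restores the ratio `ρ`.
    · have hρ := h.mul_conj
      have hρ0 : (starRingEnd ℂ) ρ ≠ 0 := right_ne_zero_of_mul_eq_one hρ
      refine ⟨α * (a * q) * (starRingEnd ℂ) ρ, by simp [hα', hq', (map_ne_zero _).1 hρ0],
        SetLike.coe_injective ?_⟩
      rw [hU, coe_planeLattice, ← (Equiv.prodComm ℤ ℤ).surjective.range_comp]
      congr 1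
      ext1 k
      simp only [Function.comp_apply, Equiv.prodComm_apply, Prod.fst_swap, Prod.snd_swap]
      rw [hU', ha, LinearIsometryEquiv.trans_apply, rotation_apply, Complex.conjLIE_apply]
      congr 1
      simp only [map_add, map_mul, Complex.conj_ofReal, map_intCast]
      linear_combination (-(k.2 : ℂ) * α * a * q) * hρ
  · rintro ⟨u, hu, rfl⟩
    have hu' : (‖u‖ : ℂ) ≠ 0 := by simpa using hu
    have hmem : u / ‖u‖ ∈ Submonoid.unitSphere ℂ := by simp [Submonoid.unitSphere, hu]
    obtain ⟨a, ha⟩ : ∃ a : Circle, (a : ℂ) = u / ‖u‖ := ⟨⟨_, hmem⟩, rfl⟩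
    refine ⟨‖u‖ / q, div_pos (norm_pos_iff.2 hu) hq,
      (complexPlane.symm.trans (rotation a)).trans complexPlane, ?_⟩
    rw [coe_planeLattice, coe_planeLattice, ← Set.range_comp]
    congr 1
    ext1 k
    simp only [Function.comp_apply, LinearIsometryEquiv.trans_apply,
      LinearIsometryEquiv.symm_apply_apply, rotation_apply, ha]
    rw [← map_smul, Complex.real_smul]
    congr 1
    push_cast
    field_simp

namespace IsWellRoundedRatio

variable {ρ : ℂ}

open Classical in
/-- The complex numbers `e` with `e (ℤ + ℤ ρ) = ℤ + ℤ ρ`. -/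
noncomputable def units (ρ : ℂ) : Finset ℂ :=
  if 2 * ρ.re = 1 then {1, -1, ρ, -ρ, ρ - 1, 1 - ρ} else {1, -1}

lemma card_units (h : IsWellRoundedRatio ρ) :
    (units ρ).card = if 2 * ρ.re = 1 then 6 else 2 := by
  have him := h.im_pos
  rw [units]
  split_ifs with h0
  · have hre : ρ.re = 1 / 2 := by linarith
    repeat rw [Finset.card_insert_of_notMem]
    · simp
    all_goals
      simp only [Finset.mem_insert, Finset.mem_singleton, not_or]
      repeat' apply And.intro
      all_goals
        intro h3
        have h4 := congrArg Complex.re h3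
        have h5 := congrArg Complex.im h3
        simp only [Complex.one_re, Complex.one_im, Complex.neg_re, Complex.neg_im, Complex.sub_re,
          Complex.sub_im, hre] at h4 h5
        linarith
  · exact Finset.card_pair (by norm_num)

lemma sq_eq_of_mem_units (h : IsWellRoundedRatio ρ) (h0 : 2 * ρ.re = 1) : ρ * ρ = ρ - 1 := by
  rw [h.sq_eq, h0]
  simp

lemma exists_inv_units (h : IsWellRoundedRatio ρ) {e : ℂ} (he : e ∈ units ρ) :
    ∃ e' ∈ units ρ, e' * e = 1 := by
  rw [units] at he ⊢
  split_ifs at he ⊢ with h0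
  · have hs := h.sq_eq_of_mem_units h0
    simp only [Finset.mem_insert, Finset.mem_singleton] at he
    rcases he with rfl | rfl | rfl | rfl | rfl | rfl
    · exact ⟨1, by simp, by ring⟩
    · exact ⟨-1, by simp, by ring⟩
    · exact ⟨1 - e, by simp, by linear_combination -hs⟩
    · exact ⟨ρ - 1, by simp, by linear_combination -hs⟩
    · exact ⟨-ρ, by simp, by linear_combination -hs⟩
    · exact ⟨ρ, by simp, by linear_combination -hs⟩
  · simp only [Finset.mem_insert, Finset.mem_singleton] at he
    rcases he with rfl | rfl
    · exact ⟨1, by simp, by ring⟩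
    · exact ⟨-1, by simp, by ring⟩

lemma planeLattice_mul_le (h : IsWellRoundedRatio ρ) {e : ℂ} (he : e ∈ units ρ) (u : ℂ) :
    planeLattice (e * u) (ρ * (e * u)) ≤ planeLattice u (ρ * u) := by
  suffices hs : ∃ m n k l : ℤ, e = m + n * ρ ∧ ρ * e = k + l * ρ by
    obtain ⟨m, n, k, l, h1, h2⟩ := hs
    rw [planeLattice_le_iff, complexPlane_mem_planeLattice, complexPlane_mem_planeLattice]
    exact ⟨⟨m, n, by rw [h1]; ring⟩, ⟨k, l, by rw [← mul_assoc, h2]; ring⟩⟩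
  rw [units] at he
  split_ifs at he with h0
  · have hs := h.sq_eq_of_mem_units h0
    simp only [Finset.mem_insert, Finset.mem_singleton] at he
    rcases he with rfl | rfl | rfl | rfl | rfl | rfl
    · exact ⟨1, 0, 0, 1, by simp, by simp⟩
    · exact ⟨-1, 0, 0, -1, by simp, by simp⟩
    · exact ⟨0, 1, -1, 1, by simp, by push_cast; linear_combination hs⟩
    · exact ⟨0, -1, 1, -1, by simp, by push_cast; linear_combination -hs⟩
    · exact ⟨-1, 1, -1, 0, by push_cast; ring, by push_cast; linear_combination hs⟩
    · exact ⟨1, -1, 1, 0, by push_cast; ring, by push_cast; linear_combination -hs⟩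
  · simp only [Finset.mem_insert, Finset.mem_singleton] at he
    rcases he with rfl | rfl
    · exact ⟨1, 0, 0, 1, by simp, by simp⟩
    · exact ⟨-1, 0, 0, -1, by simp, by simp⟩

/-- If the lattices agree, `z/u` and `u/z` both lie in `ℤ + ℤρ`. Nonzero elements there have norm at
least 1, so both have norm exactly 1, leaving finitely many candidates. -/
lemma planeLattice_mul_eq_iff (h : IsWellRoundedRatio ρ) {u z : ℂ} (hu : u ≠ 0) (hz : z ≠ 0) :
    planeLattice z (ρ * z) = planeLattice u (ρ * u) ↔ ∃ e ∈ units ρ, z = e * u := by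
  constructor
  · intro heq
    obtain ⟨m, n, hmn⟩ := complexPlane_mem_planeLattice.1 (heq ▸ left_mem_planeLattice z (ρ * z))
    obtain ⟨k, l, hkl⟩ := complexPlane_mem_planeLattice.1 (heq ▸ right_mem_planeLattice z (ρ * z))
    obtain ⟨m', n', hmn'⟩ :=
      complexPlane_mem_planeLattice.1 (heq.symm ▸ left_mem_planeLattice u (ρ * u))
    have hz' : z = (m + n * ρ) * u := by rw [hmn]; ring
    have hu' : u = (m' + n' * ρ) * z := by
      conv_lhs => rw [hmn']
      ring
    have hne : m ≠ 0 ∨ n ≠ 0 := by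
      by_contra! h0
      rw [h0.1, h0.2] at hz'
      simp [hz] at hz'
    have hne' : m' ≠ 0 ∨ n' ≠ 0 := by
      by_contra! h0
      rw [h0.1, h0.2] at hu'
      simp [hu] at hu'
    have hprod : Complex.normSq (m + n * ρ) * Complex.normSq (m' + n' * ρ) = 1 := by
      rw [← map_mul]
      have : ((m + n * ρ) * (m' + n' * ρ) : ℂ) = 1 := by
        refine mul_right_cancel₀ hz ?_
        linear_combination (-(m + n * ρ : ℂ)) * hu' - hz'
      rw [this, map_one]
    have hone : Complex.normSq (m + n * ρ) = 1 := by
      have h1 := h.one_le_normSq hne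
      have h2 := h.one_le_normSq hne'
      nlinarith
    rw [h.normSq_combination] at hone
    refine ⟨m + n * ρ, ?_, hz'⟩
    have hre := h.re_pos
    have hre' := h.re_le
    have hbd : (m ^ 2 + n ^ 2 : ℝ) ≤ 2 := by
      nlinarith [sq_nonneg (m + n : ℝ), sq_nonneg (m - n : ℝ), sq_nonneg (m : ℝ), sq_nonneg (n : ℝ)]
    have hbd' : m ^ 2 + n ^ 2 ≤ 2 := by exact_mod_cast hbd
    have hm1 : -1 ≤ m := by nlinarith
    have hm2 : m ≤ 1 := by nlinarith
    have hn1 : -1 ≤ n := by nlinarith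
    have hn2 : n ≤ 1 := by nlinarith
    -- Compare coefficients of `ρu` in `ρz`, using `ρ² = 2(Re ρ)ρ - 1`. For `n = ±1` this makes `2
    -- Re ρ` an integer, impossible when it lies strictly between 0 and 1.
    have hint : (l : ℝ) = m + n * (2 * ρ.re) := by
      have h1 := eq_zero_of_cross_ne_zero (h.cross_pos hu).ne' (m := k + n)
        (n := l - (m + n * (2 * ρ.re))) (by
          have hs := h.sq_eq
          push_cast at hs ⊢
          linear_combination -hkl + ρ * hz' + n * u * hs)
      linarith [h1.2]
    rw [units]
    split_ifs with h0
    · have hre2 : ρ.re = 1 / 2 := by linarith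
      interval_cases m <;> interval_cases n <;> first
        | (exfalso; norm_num [hre2] at hone; done)
        | simp [sub_eq_add_neg, add_comm]
    · have hn0 : n = 0 := by
        have hlt : 2 * ρ.re < 1 := lt_of_le_of_ne (by linarith) h0
        by_contra hn
        have h3 : (n : ℝ) * (l - m) = n ^ 2 * (2 * ρ.re) := by rw [hint]; ring
        have h4 : (n : ℝ) ^ 2 = 1 := by
          have : n ^ 2 = 1 := by
            have : 0 < n ^ 2 := by positivity
            nlinarith
          exact_mod_cast this
        rw [h4, one_mul] at h3
        have h5 : (0 : ℝ) < (n * (l - m) : ℤ) := by push_cast; linarith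
        have h6 : ((n * (l - m) : ℤ) : ℝ) < 1 := by push_cast; linarith
        have h7 : 0 < n * (l - m) := by exact_mod_cast h5
        have h8 : n * (l - m) < 1 := by exact_mod_cast h6
        omega
      subst hn0
      have hm : m ^ 2 = 1 := by
        have : (m : ℝ) ^ 2 = 1 := by simpa using hone
        exact_mod_cast this
      rcases mul_self_eq_one_iff.1 ((sq m).symm.trans hm) with rfl | rfl <;> simp
  · rintro ⟨e, he, rfl⟩
    obtain ⟨e', he', h1⟩ := h.exists_inv_units he
    refine le_antisymm (h.planeLattice_mul_le he u) ?_
    have := h.planeLattice_mul_le he' (e * u)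
    rwa [← mul_assoc e' e u, h1, one_mul] at this

end IsWellRoundedRatio

/-! ### Summation over fibres of constant size. -/

lemma tsum_comp_of_card_fiber {X Y : Type*} (φ : X → Y) (g : Y → ℂ) {w : ℕ} (hw : w ≠ 0)
    (hfib : ∀ y, Nat.card {x // φ x = y} = w) (hs : Summable fun x => ‖g (φ x)‖) :
    (Summable fun y => ‖g y‖) ∧ ∑' x, g (φ x) = w * ∑' y, g y := by
  have hsurj : Function.Surjective φ := fun y => by
    have : Nonempty {x // φ x = y} := (Nat.card_ne_zero.1 (by rw [hfib]; exact hw)).1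
    exact ⟨this.some.1, this.some.2⟩
  obtain ⟨σ, hσ⟩ := hsurj.hasRightInverse
  refine ⟨(hs.comp_injective hσ.injective).congr fun y => by simp [hσ y], ?_⟩
  have hs' : Summable fun x => g (φ x) := Summable.of_norm hs
  have hs'' := ((Equiv.sigmaFiberEquiv φ).summable_iff (f := fun x => g (φ x))).2 hs'
  rw [← (Equiv.sigmaFiberEquiv φ).tsum_eq, ← tsum_mul_left]
  refine hs''.tsum_sigma.trans ?_
  refine tsum_congr fun y => ?_
  have : ∀ x : {x // φ x = y}, g (φ (Equiv.sigmaFiberEquiv φ ⟨y, x⟩)) = g y := fun x => by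
    simp [x.2]
  refine (tsum_congr this).trans ?_
  rw [tsum_const, hfib, nsmul_eq_mul]

/-! ### The lattices `Ω_D(p,q)` in the complex plane. -/

/-- The point of the lattice `Ω_D(p,q)`, seen in `ℂ`, with coordinates `v`. -/
noncomputable def latticePoint (D p r q : ℕ) (v : ℤ × ℤ) : ℂ :=
  ⟨v.1 * p + v.2 * q, v.1 * r * √(D : ℝ)⟩

/-- The ratio of the two basis vectors of the lattice `Ω_D(p,q)`, seen in `ℂ`. -/
noncomputable def latticeRatio (D p r q : ℕ) : ℂ := ⟨p / q, r * √(D : ℝ) / q⟩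

namespace IsIWRParam

variable {D p r q : ℕ}

lemma sqrt_pos (h : IsIWRParam D p r q) : 0 < √(D : ℝ) :=
  Real.sqrt_pos.2 (Nat.cast_pos.2 h.D_pos)

lemma eq_real (h : IsIWRParam D p r q) : (p : ℝ) ^ 2 + (r * √(D : ℝ)) ^ 2 = q ^ 2 := by
  rw [mul_pow, Real.sq_sqrt (Nat.cast_nonneg _), mul_comm]
  exact_mod_cast h.eq

lemma isWellRoundedRatio (h : IsIWRParam D p r q) :
    IsWellRoundedRatio (latticeRatio D p r q) := by
  have hq : (0 : ℝ) < q := Nat.cast_pos.2 h.q_pos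
  have hp : (0 : ℝ) < p := Nat.cast_pos.2 h.p_pos
  have hr : (0 : ℝ) < r := Nat.cast_pos.2 h.r_pos
  have hD := h.sqrt_pos
  refine ⟨?_, ?_, h.le_half, ?_⟩
  · simp only [latticeRatio]
    rw [div_pow, div_pow, ← add_div, h.eq_real, div_self (by positivity)]
  · simp only [latticeRatio]; positivity
  · simp only [latticeRatio]; positivity

lemma omega_eq (h : IsIWRParam D p r q) :
    Omega D p r q = planeLattice (q : ℝ) (latticeRatio D p r q * (q : ℝ)) := by
  have hq : (q : ℝ) ≠ 0 := Nat.cast_ne_zero.2 h.q_pos.ne'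
  rw [Omega, planeLattice]
  congr 1
  simp [latticeRatio, hq]

/-- The coordinates are in reverse order: `v.1` goes with the second column of the basis matrix, to
match the `(x,y)` of the congruences. -/
lemma latticePoint_eq (h : IsIWRParam D p r q) (v : ℤ × ℤ) :
    latticePoint D p r q v = v.2 * (q : ℝ) + v.1 * (latticeRatio D p r q * (q : ℝ)) := by
  have hq : (q : ℝ) ≠ 0 := Nat.cast_ne_zero.2 h.q_pos.ne'
  apply Complex.ext
  · simp [latticePoint, latticeRatio, hq]
    ring
  · simp [latticePoint, latticeRatio, hq]
    field_simp

lemma mem_omega (h : IsIWRParam D p r q) {z : ℂ} :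
    complexPlane z ∈ Omega D p r q ↔ ∃ v, z = latticePoint D p r q v := by
  rw [h.omega_eq, complexPlane_mem_planeLattice]
  simp only [h.latticePoint_eq, Prod.exists]
  exact exists_comm

lemma latticePoint_injective (h : IsIWRParam D p r q) :
    Function.Injective (latticePoint D p r q) := fun v w hvw => by
  rw [h.latticePoint_eq, h.latticePoint_eq] at hvw
  have hq : ((q : ℝ) : ℂ) ≠ 0 := by exact_mod_cast h.q_pos.ne'
  obtain ⟨h2, h1⟩ := eq_of_cross_ne_zero (h.isWellRoundedRatio.cross_pos hq).ne' hvw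
  exact Prod.ext h1 h2

lemma latticePoint_ne_zero (h : IsIWRParam D p r q) {v : ℤ × ℤ} (hv : v ≠ 0) :
    latticePoint D p r q v ≠ 0 := fun h0 => hv (h.latticePoint_injective (by
  rw [h0]; apply Complex.ext <;> simp [latticePoint]))

end IsIWRParam

/-- The squared norm of the point of `Ω_D(p,q)` with coordinates `v`. -/
def latticeNorm (D p r q : ℕ) (v : ℤ × ℤ) : ℤ := (v.1 * p + v.2 * q) ^ 2 + D * r ^ 2 * v.1 ^ 2

lemma normSq_latticePoint (D p r q : ℕ) (v : ℤ × ℤ) :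
    Complex.normSq (latticePoint D p r q v) = latticeNorm D p r q v := by
  have := Real.sq_sqrt (Nat.cast_nonneg (α := ℝ) D)
  simp only [Complex.normSq_apply, latticePoint, latticeNorm]
  push_cast
  linear_combination (v.1 * r : ℝ) ^ 2 * this

/-! ### The congruences as the condition that `ρu` lies in `Ω₀`. -/

section Congruence

variable {D p₀ r₀ q₀ p r q : ℕ}

/-- The coordinates, multiplied by `q r₀`, of the product of a point with the ratio. -/
lemma ratio_mul_latticePoint (h₀ : IsIWRParam D p₀ r₀ q₀) (h : IsIWRParam D p r q) (v : ℤ × ℤ) :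
    ((q * r₀ : ℕ) : ℂ) * (latticeRatio D p r q * latticePoint D p₀ r₀ q₀ v) =
      latticePoint D p₀ r₀ q₀ ((p₀ * r + r₀ * p) * v.1 + q₀ * r * v.2,
        -(q₀ * r * v.1 + (p₀ * r - r₀ * p) * v.2)) := by
  have hq : (q : ℝ) ≠ 0 := Nat.cast_ne_zero.2 h.q_pos.ne'
  have hD := Real.sq_sqrt (Nat.cast_nonneg (α := ℝ) D)
  have he := h₀.eq_real
  rw [mul_pow] at he
  rw [← Complex.ofReal_natCast]
  apply Complex.ext
  · rw [Complex.re_ofReal_mul]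
    simp only [latticeRatio, latticePoint, Complex.mul_re]
    push_cast
    field_simp
    linear_combination (-(v.1 : ℝ) * r) * he
  · rw [Complex.im_ofReal_mul]
    simp only [latticeRatio, latticePoint, Complex.mul_im]
    push_cast
    field_simp
    ring

lemma latticePoint_smul (n : ℤ) (v : ℤ × ℤ) :
    latticePoint D p r q (n * v.1, n * v.2) = n * latticePoint D p r q v := by
  rw [← Complex.ofReal_intCast]
  apply Complex.ext
  · rw [Complex.re_ofReal_mul]; simp [latticePoint]; ring
  · rw [Complex.im_ofReal_mul]; simp [latticePoint]; ring

/-- The coordinates of `ρu` in `Ω₀` have denominator `q r₀`; the congruences say that they are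
integers. -/
lemma mem_congLattice_iff (h₀ : IsIWRParam D p₀ r₀ q₀) (h : IsIWRParam D p r q) (v : ℤ × ℤ) :
    v ∈ congLattice p₀ r₀ q₀ p r q ↔
      ∃ w, latticeRatio D p r q * latticePoint D p₀ r₀ q₀ v = latticePoint D p₀ r₀ q₀ w := by
  have hN : ((q * r₀ : ℕ) : ℂ) ≠ 0 := by exact_mod_cast (Nat.mul_pos h.q_pos h₀.r_pos).ne'
  have key := ratio_mul_latticePoint h₀ h v
  have hcast : ((q * r₀ : ℕ) : ℂ) = ((q * r₀ : ℤ) : ℂ) := by push_cast; rfl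
  constructor
  · rintro ⟨⟨y, hy⟩, ⟨x, hx⟩⟩
    refine ⟨(x, -y), mul_left_cancel₀ hN ?_⟩
    rw [key, hx, hy, hcast, ← latticePoint_smul]
    simp
  · rintro ⟨w, hw⟩
    rw [hw, hcast, ← latticePoint_smul] at key
    have h1 := h₀.latticePoint_injective key
    rw [Prod.mk.injEq] at h1
    exact ⟨⟨-w.2, by linear_combination h1.2⟩, ⟨w.1, by linear_combination -h1.1⟩⟩

/-- The inner product of `u` and `ρu` is an integer, because both lie in `Ω₀`, and equals
`(p/q)|u|²`. Hence `q` divides `p|u|²`, and `p` is prime to `q`. -/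
lemma dvd_latticeNorm (h₀ : IsIWRParam D p₀ r₀ q₀) (h : IsIWRParam D p r q) {v : ℤ × ℤ}
    (hv : v ∈ congLattice p₀ r₀ q₀ p r q) : (q : ℤ) ∣ latticeNorm D p₀ r₀ q₀ v := by
  obtain ⟨w, hw⟩ := (mem_congLattice_iff h₀ h v).1 hv
  have hq : (q : ℝ) ≠ 0 := Nat.cast_ne_zero.2 h.q_pos.ne'
  have hcop : IsCoprime (q : ℤ) p := (Nat.isCoprime_iff_coprime.2 h.coprime).symm
  refine hcop.dvd_of_dvd_mul_left
    ⟨(v.1 * p₀ + v.2 * q₀) * (w.1 * p₀ + w.2 * q₀) + D * r₀ ^ 2 * (v.1 * w.1), ?_⟩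
  have hD := Real.sq_sqrt (Nat.cast_nonneg (α := ℝ) D)
  have h1 := congrArg Complex.re hw
  have h2 := congrArg Complex.im hw
  simp only [latticeRatio, latticePoint, Complex.mul_re, Complex.mul_im] at h1 h2
  have h3 : (p * latticeNorm D p₀ r₀ q₀ v : ℝ) = q * ((v.1 * p₀ + v.2 * q₀) *
      (w.1 * p₀ + w.2 * q₀) + D * r₀ ^ 2 * (v.1 * w.1)) := by
    simp only [latticeNorm]
    push_cast
    have h4 : (p : ℝ) / q * ((v.1 * p₀ + v.2 * q₀) ^ 2 + (v.1 * r₀ * √(D : ℝ)) ^ 2) =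
        (v.1 * p₀ + v.2 * q₀) * (w.1 * p₀ + w.2 * q₀) +
          (v.1 * r₀ * √(D : ℝ)) * (w.1 * r₀ * √(D : ℝ)) := by
      linear_combination (v.1 * p₀ + v.2 * q₀ : ℝ) * h1 + (v.1 * r₀ * √(D : ℝ)) * h2
    rw [div_mul_eq_mul_div, div_eq_iff hq] at h4
    linear_combination h4 + (q * v.1 * w.1 * r₀ ^ 2 - p * v.1 ^ 2 * r₀ ^ 2 : ℝ) * hD
  exact_mod_cast h3

end Congruence

/-! ### Bases of the solution group and the form `Q`. -/

section Basis

variable {D p₀ r₀ q₀ p r q : ℕ}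

lemma finrank_congLattice (h₀ : IsIWRParam D p₀ r₀ q₀) (h : IsIWRParam D p r q) :
    Module.finrank ℤ (congLattice p₀ r₀ q₀ p r q) = 2 := by
  have h2 : Module.finrank ℤ (ℤ × ℤ) = 2 := by simp
  refine le_antisymm (h2 ▸ Submodule.finrank_le _) ?_
  -- The solution group has full rank because it contains `q r₀ ℤ²`.
  have hN : ((q : ℤ) * r₀) ≠ 0 := by exact_mod_cast (Nat.mul_pos h.q_pos h₀.r_pos).ne'
  let f : (ℤ × ℤ) →ₗ[ℤ] congLattice p₀ r₀ q₀ p r q :=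
    (LinearMap.lsmul ℤ (ℤ × ℤ) ((q : ℤ) * r₀)).codRestrict _ fun v =>
      ⟨⟨q₀ * r * v.1 + ((p₀ : ℤ) * r - r₀ * p) * v.2, by simp; ring⟩,
        ⟨((p₀ : ℤ) * r + r₀ * p) * v.1 + q₀ * r * v.2, by simp; ring⟩⟩
  have hf : Function.Injective f := fun v w hvw => by
    have h1 := congrArg Subtype.val hvw
    exact smul_right_injective _ hN h1
  exact h2 ▸ LinearMap.finrank_le_finrank_of_injective hf

lemma exists_solutionForm (h₀ : IsIWRParam D p₀ r₀ q₀) (h : IsIWRParam D p r q)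
    (B : Module.Basis (Fin 2) ℤ (congLattice p₀ r₀ q₀ p r q)) :
    ∃ a b c : ℤ, IsSolutionForm D p₀ r₀ q₀ p r q B a b c := by
  obtain ⟨a, ha⟩ := dvd_latticeNorm h₀ h (B 0).2
  obtain ⟨c, hc⟩ := dvd_latticeNorm h₀ h (B 1).2
  obtain ⟨e, he⟩ := dvd_latticeNorm h₀ h (B 0 + B 1).2
  -- Polarization: the norm of the sum of the two basis vectors determines the middle coefficient
  -- and shows that it is integral.
  refine ⟨a, e - a - c, c, fun m n x y hxy => ?_⟩
  have hx := congrArg Prod.fst hxy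
  have hy := congrArg Prod.snd hxy
  simp only [Submodule.coe_add, Submodule.coe_smul, Prod.fst_add, Prod.snd_add, Prod.smul_fst,
    Prod.smul_snd, smul_eq_mul, latticeNorm, binForm] at hx hy ha hc he ⊢
  rw [← hx, ← hy]
  linear_combination (m * n - m ^ 2) * ha + (m * n - n ^ 2) * hc - m * n * he

variable (B : Module.Basis (Fin 2) ℤ (congLattice p₀ r₀ q₀ p r q))

/-- The element of the solution group with coordinates `v`. -/
noncomputable def solution (v : ℤ × ℤ) : ℤ × ℤ :=
  ((v.1 • B 0 + v.2 • B 1 : congLattice p₀ r₀ q₀ p r q) : ℤ × ℤ)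

lemma solution_mem (v : ℤ × ℤ) : solution B v ∈ congLattice p₀ r₀ q₀ p r q := Subtype.coe_prop _

lemma solution_injective : Function.Injective (solution B) := fun v w hvw => by
  have h1 := congrArg B.repr (Subtype.coe_injective hvw)
  have h2 := DFunLike.congr_fun h1 0
  have h3 := DFunLike.congr_fun h1 1
  simp at h2 h3
  exact Prod.ext h2 h3

lemma exists_solution_eq {x : ℤ × ℤ} (hx : x ∈ congLattice p₀ r₀ q₀ p r q) :
    ∃ v, solution B v = x := by
  refine ⟨(B.repr ⟨x, hx⟩ 0, B.repr ⟨x, hx⟩ 1), ?_⟩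
  have := B.sum_repr ⟨x, hx⟩
  rw [Fin.sum_univ_two] at this
  exact congrArg Subtype.val this

lemma solution_ne_zero {v : ℤ × ℤ} (hv : v ≠ 0) : solution B v ≠ 0 := fun h0 =>
  hv (solution_injective B (h0.trans (by simp [solution])))

variable {B} {a b c : ℤ}

lemma IsSolutionForm.eq (hB : IsSolutionForm D p₀ r₀ q₀ p r q B a b c) (v : ℤ × ℤ) :
    q * binForm a b c v = latticeNorm D p₀ r₀ q₀ (solution B v) :=
  hB v.1 v.2 _ _ rfl

lemma IsSolutionForm.pos (h₀ : IsIWRParam D p₀ r₀ q₀)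
    (hB : IsSolutionForm D p₀ r₀ q₀ p r q B a b c) {v : ℤ × ℤ} (hv : v ≠ 0) :
    0 < binForm a b c v := by
  have h1 := Complex.normSq_pos.2 (h₀.latticePoint_ne_zero (solution_ne_zero B hv))
  rw [normSq_latticePoint, Int.cast_pos, ← hB.eq] at h1
  exact pos_of_mul_pos_right h1 (Int.natCast_nonneg q)

end Basis

/-! ### Parametrization of the sublattices, their indices and multiplicities. -/

section Sublattices

variable {D p₀ r₀ q₀ p r q : ℕ}

lemma isIntegralLattice_planeLattice {u v : ℂ} (h₀ : IsIWRParam D p₀ r₀ q₀) (h : cross u v ≠ 0)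
    (hle : planeLattice u v ≤ Omega D p₀ r₀ q₀) : IsIntegralLattice (planeLattice u v) := by
  rw [planeLattice_le_iff, h₀.mem_omega, h₀.mem_omega] at hle
  obtain ⟨⟨x, hx⟩, ⟨y, hy⟩⟩ := hle
  have hinner : ∀ x y : ℤ × ℤ, ∃ z : ℤ,
      (latticePoint D p₀ r₀ q₀ x).re * (latticePoint D p₀ r₀ q₀ y).re +
        (latticePoint D p₀ r₀ q₀ x).im * (latticePoint D p₀ r₀ q₀ y).im = z := fun x y => by
    refine ⟨(x.1 * p₀ + x.2 * q₀) * (y.1 * p₀ + y.2 * q₀) + D * r₀ ^ 2 * (x.1 * y.1), ?_⟩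
    have := Real.sq_sqrt (Nat.cast_nonneg (α := ℝ) D)
    simp only [latticePoint]
    push_cast
    linear_combination (x.1 * y.1 * r₀ ^ 2 : ℝ) * this
  refine ⟨_, ⟨by rw [det_planeLattice]; exact h, rfl⟩, fun i j => ?_⟩
  subst hx hy
  fin_cases i <;> fin_cases j <;> simpa [Matrix.mul_apply, Fin.sum_univ_two] using hinner _ _

lemma mem_iwrSublattices_iff (h₀ : IsIWRParam D p₀ r₀ q₀) (h : IsIWRParam D p r q)
    {Λ : AddSubgroup Plane} : Λ ∈ iwrSublattices D p₀ r₀ q₀ p r q ↔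
      ∃ x ∈ congLattice p₀ r₀ q₀ p r q, x ≠ 0 ∧ Λ = planeLattice (latticePoint D p₀ r₀ q₀ x)
        (latticeRatio D p r q * latticePoint D p₀ r₀ q₀ x) := by
  have hρ := h.isWellRoundedRatio
  have hq : (0 : ℝ) < q := Nat.cast_pos.2 h.q_pos
  constructor
  · rintro ⟨hle, -, -, hsim⟩
    rw [h.omega_eq, similar_planeLattice_iff hρ hq] at hsim
    obtain ⟨u, hu, rfl⟩ := hsim
    rw [planeLattice_le_iff, h₀.mem_omega, h₀.mem_omega] at hle
    obtain ⟨⟨x, rfl⟩, hy⟩ := hle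
    refine ⟨x, (mem_congLattice_iff h₀ h x).2 hy, ?_, rfl⟩
    rintro rfl
    exact hu (by apply Complex.ext <;> simp [latticePoint])
  · rintro ⟨x, hx, hx0, rfl⟩
    have hu := h₀.latticePoint_ne_zero hx0
    have hle : planeLattice (latticePoint D p₀ r₀ q₀ x)
        (latticeRatio D p r q * latticePoint D p₀ r₀ q₀ x) ≤ Omega D p₀ r₀ q₀ := by
      rw [planeLattice_le_iff, h₀.mem_omega, h₀.mem_omega]
      exact ⟨⟨x, rfl⟩, (mem_congLattice_iff h₀ h x).1 hx⟩
    refine ⟨hle, isIntegralLattice_planeLattice h₀ (hρ.cross_pos hu).ne' hle,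
      hρ.isWellRounded hu, ?_⟩
    rw [h.omega_eq, similar_planeLattice_iff hρ hq]
    exact ⟨_, hu, rfl⟩

/-- The areas are `|u|² r√D/q` and `q₀ r₀√D`; the factor `√D` cancels in their ratio. -/
lemma relIndex_mul (h₀ : IsIWRParam D p₀ r₀ q₀) (h : IsIWRParam D p r q)
    {x : ℤ × ℤ} (hx : x ∈ congLattice p₀ r₀ q₀ p r q) (hx0 : x ≠ 0) :
    ((planeLattice (latticePoint D p₀ r₀ q₀ x)
        (latticeRatio D p r q * latticePoint D p₀ r₀ q₀ x)).relIndex (Omega D p₀ r₀ q₀) : ℝ) *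
      (r₀ * q₀ * q) = r * latticeNorm D p₀ r₀ q₀ x := by
  have hmem := (mem_iwrSublattices_iff h₀ h).2 ⟨x, hx, hx0, rfl⟩
  have hle := hmem.1
  have hu := h₀.latticePoint_ne_zero hx0
  have hq₀ : ((q₀ : ℝ) : ℂ) ≠ 0 := by exact_mod_cast h₀.q_pos.ne'
  have hq₀' : (q₀ : ℝ) ≠ 0 := Nat.cast_ne_zero.2 h₀.q_pos.ne'
  have hq' : (q : ℝ) ≠ 0 := Nat.cast_ne_zero.2 h.q_pos.ne'
  have h1 := h.isWellRoundedRatio.cross_pos hu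
  have h2 := h₀.isWellRoundedRatio.cross_pos hq₀
  have hD := h.sqrt_pos
  rw [h₀.omega_eq] at hle ⊢
  have key := relIndex_planeLattice h1.ne' h2.ne' hle
  rw [abs_of_pos h1, abs_of_pos h2, IsWellRoundedRatio.cross_mul, IsWellRoundedRatio.cross_mul,
    normSq_latticePoint, Complex.normSq_ofReal] at key
  generalize AddSubgroup.relIndex (_ : AddSubgroup Plane) _ = N at key ⊢
  simp only [latticeRatio] at key
  field_simp at key
  linear_combination key

variable {B : Module.Basis (Fin 2) ℤ (congLattice p₀ r₀ q₀ p r q)} {a b c : ℤ}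

/-- The sublattice attached to a nonzero coordinate vector of the solution group. -/
noncomputable def sublattice (h₀ : IsIWRParam D p₀ r₀ q₀) (h : IsIWRParam D p r q)
    (B : Module.Basis (Fin 2) ℤ (congLattice p₀ r₀ q₀ p r q))
    (v : {v : ℤ × ℤ // v ≠ 0}) : iwrSublattices D p₀ r₀ q₀ p r q :=
  ⟨planeLattice (latticePoint D p₀ r₀ q₀ (solution B v))
    (latticeRatio D p r q * latticePoint D p₀ r₀ q₀ (solution B v)),
    (mem_iwrSublattices_iff h₀ h).2
      ⟨solution B v, solution_mem B v, solution_ne_zero B v.2, rfl⟩⟩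

lemma zetaTerm_sublattice (h₀ : IsIWRParam D p₀ r₀ q₀) (h : IsIWRParam D p r q)
    (hB : IsSolutionForm D p₀ r₀ q₀ p r q B a b c) (v : {v : ℤ × ℤ // v ≠ 0}) (s : ℂ) :
    zetaTerm D p₀ r₀ q₀ s (sublattice h₀ h B v) =
      ((r₀ : ℂ) * (q₀ : ℂ) / (r : ℂ)) ^ s * epsteinTerm a b c s v := by
  have hq : (q : ℝ) ≠ 0 := Nat.cast_ne_zero.2 h.q_pos.ne'
  have hr : (r : ℝ) ≠ 0 := Nat.cast_ne_zero.2 h.r_pos.ne'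
  have key := relIndex_mul h₀ h (solution_mem B v) (solution_ne_zero B v.2)
  rw [← hB.eq v] at key
  have hi : (binForm a b c v : ℝ) = ((r₀ * q₀ / r : ℝ) *
      ((sublattice h₀ h B v : AddSubgroup Plane).relIndex (Omega D p₀ r₀ q₀) : ℕ)) := by
    change (binForm a b c v : ℝ) = (r₀ * q₀ / r : ℝ) *
      ((planeLattice _ _).relIndex (Omega D p₀ r₀ q₀) : ℕ)
    push_cast at key
    field_simp
    refine mul_right_cancel₀ hq ?_
    linear_combination -key
  have hK : ((r₀ : ℂ) * q₀ / r) = ((r₀ * q₀ / r : ℝ) : ℂ) := by push_cast; rfl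
  have hK0 : ((r₀ * q₀ / r : ℝ) : ℂ) ≠ 0 := by
    have h1 : (0 : ℝ) < r₀ := Nat.cast_pos.2 h₀.r_pos
    have h2 : (0 : ℝ) < q₀ := Nat.cast_pos.2 h₀.q_pos
    have h3 : (0 : ℝ) < r := Nat.cast_pos.2 h.r_pos
    exact_mod_cast (by positivity : (r₀ * q₀ / r : ℝ) ≠ 0)
  have hKs : ((r₀ * q₀ / r : ℝ) : ℂ) ^ s ≠ 0 := by rw [Ne, Complex.cpow_eq_zero_iff]; tauto
  rw [zetaTerm, epsteinTerm, ← Complex.ofReal_intCast, hi, Complex.ofReal_mul,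
    Complex.mul_cpow_ofReal_nonneg (by positivity) (Nat.cast_nonneg _), hK,
    Complex.ofReal_natCast]
  field_simp

lemma card_fiber_sublattice (h₀ : IsIWRParam D p₀ r₀ q₀) (h : IsIWRParam D p r q)
    (y : iwrSublattices D p₀ r₀ q₀ p r q) :
    Nat.card {v // sublattice h₀ h B v = y} = if q = 2 * p then 6 else 2 := by
  have hρ := h.isWellRoundedRatio
  obtain ⟨x, hx, hx0, hy⟩ := (mem_iwrSublattices_iff h₀ h).1 y.2
  have hu := h₀.latticePoint_ne_zero hx0
  have hex : ∀ v, sublattice h₀ h B v = y ↔ ∃ e ∈ IsWellRoundedRatio.units (latticeRatio D p r q),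
      latticePoint D p₀ r₀ q₀ (solution B v) = e * latticePoint D p₀ r₀ q₀ x := fun v => by
    rw [← hρ.planeLattice_mul_eq_iff hu (h₀.latticePoint_ne_zero (solution_ne_zero B v.2)), ← hy,
      Subtype.ext_iff]
    rfl
  have hcard : Nat.card {v // sublattice h₀ h B v = y} =
      Nat.card (IsWellRoundedRatio.units (latticeRatio D p r q)) := by
    refine Nat.card_congr (Equiv.ofBijective
      (fun v => ⟨latticePoint D p₀ r₀ q₀ (solution B v.1) / latticePoint D p₀ r₀ q₀ x, ?_⟩) ⟨?_, ?_⟩)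
    · obtain ⟨e, he, h1⟩ := (hex v.1).1 v.2
      rwa [h1, mul_div_cancel_right₀ _ hu]
    · intro v w hvw
      have h1 := congrArg Subtype.val hvw
      exact Subtype.ext (Subtype.ext (solution_injective B
        (h₀.latticePoint_injective ((div_left_inj' hu).1 h1))))
    · rintro ⟨e, he⟩
      obtain ⟨e', -, hee⟩ := hρ.exists_inv_units he
      have he0 : e ≠ 0 := right_ne_zero_of_mul_eq_one hee
      -- The multiple `eu` generates the same sublattice of `Ω₀`, so it again comes from a solution
      -- of the congruences.
      have heq := (hρ.planeLattice_mul_eq_iff hu (mul_ne_zero he0 hu)).2 ⟨e, he, rfl⟩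
      have hle : planeLattice (e * latticePoint D p₀ r₀ q₀ x)
          (latticeRatio D p r q * (e * latticePoint D p₀ r₀ q₀ x)) ≤ Omega D p₀ r₀ q₀ := by
        rw [heq, ← hy]
        exact y.2.1
      rw [planeLattice_le_iff, h₀.mem_omega, h₀.mem_omega] at hle
      obtain ⟨⟨z, hz⟩, hz'⟩ := hle
      rw [hz] at hz'
      obtain ⟨v, hv⟩ := exists_solution_eq B ((mem_congLattice_iff h₀ h z).2 hz')
      have hv0 : v ≠ 0 := by
        rintro rfl
        refine mul_ne_zero he0 hu ?_
        rw [hz, ← hv]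
        apply Complex.ext <;> simp [latticePoint, solution]
      have hve : latticePoint D p₀ r₀ q₀ (solution B v) = e * latticePoint D p₀ r₀ q₀ x := by
        rw [hv, hz]
      refine ⟨⟨⟨v, hv0⟩, (hex _).2 ⟨e, he, hve⟩⟩, Subtype.ext ?_⟩
      change latticePoint D p₀ r₀ q₀ (solution B v) / _ = e
      rw [hve, mul_div_cancel_right₀ _ hu]
  rw [hcard, Nat.card_eq_fintype_card, Fintype.card_coe, hρ.card_units]
  have hq : (q : ℝ) ≠ 0 := Nat.cast_ne_zero.2 h.q_pos.ne'
  have hiff : 2 * (latticeRatio D p r q).re = 1 ↔ q = 2 * p := by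
    simp only [latticeRatio]
    rw [mul_div_assoc', div_eq_one_iff_eq hq, eq_comm]
    exact_mod_cast Iff.rfl
  simp only [hiff]

lemma zetaZ_eq (h₀ : IsIWRParam D p₀ r₀ q₀) (h : IsIWRParam D p r q)
    (hB : IsSolutionForm D p₀ r₀ q₀ p r q B a b c) {s : ℂ}
    (hs : Summable fun v : {v : ℤ × ℤ // v ≠ 0} => ‖epsteinTerm a b c s v‖) :
    (Summable fun Λ : iwrSublattices D p₀ r₀ q₀ p r q => ‖zetaTerm D p₀ r₀ q₀ s Λ‖) ∧
    zetaZ D p₀ r₀ q₀ p r q s = 1 / (if q = 2 * p then 6 else 2) *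
      ((r₀ : ℂ) * (q₀ : ℂ) / (r : ℂ)) ^ s * epsteinZeta a b c s := by
  have hw : (if q = 2 * p then 6 else 2) ≠ 0 := by split_ifs <;> norm_num
  obtain ⟨h1, h2⟩ := tsum_comp_of_card_fiber (sublattice h₀ h B)
    (fun Λ => zetaTerm D p₀ r₀ q₀ s Λ) hw (card_fiber_sublattice h₀ h) (by
      simp only [zetaTerm_sublattice h₀ h hB, norm_mul]
      exact hs.mul_left _)
  refine ⟨h1, ?_⟩
  simp only [zetaTerm_sublattice h₀ h hB, tsum_mul_left] at h2
  rw [zetaZ, epsteinZeta, mul_assoc, h2]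
  split_ifs <;> push_cast <;> ring

end Sublattices

theorem lemma3p4 (D p₀ r₀ q₀ p r q : ℕ)
    (h₀ : IsIWRParam D p₀ r₀ q₀) (h : IsIWRParam D p r q) :
    -- the Dirichlet series converges absolutely for `Re s > 1`
    (∀ s : ℂ, 1 < s.re →
      Summable fun Λ : iwrSublattices D p₀ r₀ q₀ p r q => ‖zetaTerm D p₀ r₀ q₀ s Λ‖) ∧
    -- it continues analytically to `ℂ \ {1}`, with a simple pole at `1`
    (∃ F : ℂ → ℂ,
      (∀ s : ℂ, 1 < s.re → F s = zetaZ D p₀ r₀ q₀ p r q s) ∧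
      AnalyticOnNhd ℂ F {1}ᶜ ∧ MeromorphicAt F 1 ∧ meromorphicOrderAt F 1 = -1) ∧
    -- it is expressed by the Epstein zeta-function of a positive definite integral form
    (∃ (B : Module.Basis (Fin 2) ℤ (congLattice p₀ r₀ q₀ p r q)) (a b c : ℤ),
      IsSolutionForm D p₀ r₀ q₀ p r q B a b c ∧
      (∀ v : ℤ × ℤ, v ≠ 0 → 0 < binForm a b c v) ∧
      ∀ s : ℂ, 1 < s.re →
        (Summable fun v : {v : ℤ × ℤ // v ≠ 0} => ‖epsteinTerm a b c s v‖) ∧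
        zetaZ D p₀ r₀ q₀ p r q s =
          1 / (if q = 2 * p then 6 else 2) *
            ((r₀ : ℂ) * (q₀ : ℂ) / (r : ℂ)) ^ s * epsteinZeta a b c s) := by
  let B := Module.finBasisOfFinrankEq ℤ _ (finrank_congLattice h₀ h)
  obtain ⟨a, b, c, hB⟩ := exists_solutionForm h₀ h B
  have hpos : ∀ v : ℤ × ℤ, v ≠ 0 → 0 < binForm a b c v := fun v hv => hB.pos h₀ hv
  obtain ⟨G, hG, hG1, hGs⟩ := epsteinZeta_continuation hpos
  have hz := fun {s : ℂ} (hs : 1 < s.re) => zetaZ_eq h₀ h hB (hGs s hs).1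
  have hK : ((r₀ : ℂ) * q₀ / r) ≠ 0 := by
    simp [h₀.r_pos.ne', h₀.q_pos.ne', h.r_pos.ne']
  have hw : (1 / (if q = 2 * p then 6 else 2) : ℂ) ≠ 0 := by split_ifs <;> norm_num
  set w : ℂ := 1 / (if q = 2 * p then 6 else 2)
  have hH : Differentiable ℂ fun s => w * ((r₀ : ℂ) * q₀ / r) ^ s * G s := by
    refine Differentiable.mul (Differentiable.const_mul (fun s => ?_) _) hG
    exact DifferentiableAt.const_cpow differentiableAt_id (Or.inl hK)
  have hH1 : w * ((r₀ : ℂ) * q₀ / r) ^ (1 : ℂ) * G 1 ≠ 0 :=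
    mul_ne_zero (mul_ne_zero hw (by rwa [Complex.cpow_one])) hG1
  have hmer : MeromorphicAt
      (fun s => (s - 1)⁻¹ * (w * ((r₀ : ℂ) * q₀ / r) ^ s * G s)) 1 :=
    (((MeromorphicAt.id 1).sub (MeromorphicAt.const 1 1)).inv).mul (hH.analyticAt 1).meromorphicAt
  refine ⟨fun s hs => (hz hs).1, ⟨fun s => (s - 1)⁻¹ * (w * ((r₀ : ℂ) * q₀ / r) ^ s * G s),
    fun s hs => ?_, fun s hs => ?_, hmer, ?_⟩, B, a, b, c, hB, hpos,
    fun s hs => ⟨(hGs s hs).1, (hz hs).2⟩⟩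
  · rw [(hz hs).2, (hGs s hs).2]
    ring
  · exact ((analyticAt_id.sub analyticAt_const).inv (sub_ne_zero.2 hs)).mul (hH.analyticAt s)
  -- The pole is exactly simple because the entire cofactor of `(s - 1)⁻¹` does not vanish at 1.
  · refine (meromorphicOrderAt_eq_int_iff (n := -1) hmer).2 ⟨_, hH.analyticAt 1, hH1, ?_⟩
    exact Filter.Eventually.of_forall fun s => by simp
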